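/- All monoids are commutative, written multiplicatively (no zero element is required). For a monoid $M$, $\mathrm{Spec}(M)$ is the set of prime ideals of $M$ (ideals, possibly empty, whose complement is a submonoid), with the topology with basis $D(f)=\{\mathfrak p \mid f\notin\mathfrak p\}$, $f\in M$, and with its structure sheaf of monoids, $D(f)\mapsto M_f$. A monoid scheme is a topological space with a sheaf of monoids that is locally isomorphic to some $\mathrm{Spec}(M)$; morphisms are the morphisms of spaces with sheaves of monoids that are local on stalks. A monoid scheme is affine if it is isomorphic to some $\mathrm{Spec}(M)$. It is separated if its diagonal $X\to X\times X$ is a closed immersion, i.e. the preimage of each affine open $U$ is affine or empty, and the map on sections from $U$ to its preimage is surjective. Let $X$ be a monoid scheme. i) Suppose that $X$ is affine. Then for every sheaf of groups $F$ on $X$ the pointed set $H^1(X,F)=\operatorname{colim}_{\mathcal U}H^1(\mathcal U,F)$ (the colimit over all open covers) is trivial. Moreover, for every sheaf of abelian groups $F$ on $X$ one has $H^i(X,F)=0$ for all $i\ge 1$. ii) Suppose that $X$ is separated, and let $\mathcal U=(U_i)_{i\in I}$ be a cover of $X$ by open affine monoid subschemes. Then for every sheaf of abelian groups $F$ on $X$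 and every $n\ge 0$, sheaf cohomology is isomorphic to the Čech cohomology of $\mathcal U$, $H^n(X,F)\cong H^n(\mathcal U,F)$, naturally in $F$. -/

import Mathlib

open CategoryTheory TopologicalSpace Opposite

universe u

/-! ### The spectrum of a commutative monoid -/

/-- A prime ideal of a commutative monoid: an ideal (possibly empty) whose complement
is a submonoid. -/
@[ext]
structure MonoidPrime (M : Type u) [CommMonoid M] where
  carrier : Set M
  mul_mem' : ∀ (a : M) {x : M}, x ∈ carrier → a * x ∈ carrier
  one_notMem' : (1 : M) ∉ carrier
  mem_or_mem' : ∀ {x y : M}, x * y ∈ carrier → x ∈ carrier ∨ y ∈ carrier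

namespace MonoidPrime

variable {M : Type u} [CommMonoid M]

/-- The complement of a prime ideal, as a submonoid. -/
def compl (p : MonoidPrime M) : Submonoid M where
  carrier := p.carrierᶜ
  one_mem' := p.one_notMem'
  mul_mem' := fun ha hb h => (p.mem_or_mem' h).elim ha hb

/-- The set `D(f)` of the prime ideals not containing `f`. -/
def basicOpen (f : M) : Set (MonoidPrime M) := {p | f ∉ p.carrier}

/-- The topology on the spectrum: the sets `D(f)` are closed under finite intersections
(`D(f) ∩ D(g) = D(fg)`, `D(1)` is everything), and they form a basis of the topology. -/
instance : TopologicalSpace (MonoidPrime M) :=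
  TopologicalSpace.generateFrom (Set.range basicOpen)

end MonoidPrime

namespace MonoidSpec

variable (M : Type u) [CommMonoid M]

/-- The spectrum of `M` as a topological space. -/
def top : TopCat.{u} := TopCat.of (MonoidPrime M)

/-- The localisation of `M` at a prime ideal. -/
abbrev LocalizationAt (p : top M) : Type u := Localization (MonoidPrime.compl (M := M) p)

/-- A function `p ↦ s(p) ∈ M_p` on an open set `U` which is a fraction `a / b` on all of `U`. -/
def isFractionPrelocal : TopCat.PrelocalPredicate (LocalizationAt M) where
  pred {U} s := ∃ a b : M, ∀ p : U, ∃ hb : b ∈ MonoidPrime.compl (M := M) p.1,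
    s p = Localization.mk a ⟨b, hb⟩
  res := by
    rintro V U i s ⟨a, b, h⟩
    exact ⟨a, b, fun p => h (i p)⟩

/-- The functions `p ↦ s(p) ∈ M_p` which are locally fractions of elements of `M`. -/
def isLocallyFraction : TopCat.LocalPredicate (LocalizationAt M) :=
  (isFractionPrelocal M).sheafify

/-- The monoid of the sections of the structure sheaf on an open set `U`. -/
def sections (U : Opens (top M)) : Submonoid (∀ p : U, LocalizationAt M p.1) where
  carrier := {s | (isLocallyFraction M).pred s}
  one_mem' := fun p => ⟨U, p.2, 𝟙 _, 1, 1, fun q =>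
    ⟨Submonoid.one_mem _, Localization.mk_one.symm⟩⟩
  mul_mem' := by
    intro s t hs ht p
    obtain ⟨V, hV, i, a, b, h⟩ := hs p
    obtain ⟨W, hW, j, c, d, k⟩ := ht p
    refine ⟨V ⊓ W, ⟨hV, hW⟩, Opens.infLELeft _ _ ≫ i, a * c, b * d, fun q => ?_⟩
    obtain ⟨hb, e⟩ := h ⟨q.1, q.2.1⟩
    obtain ⟨hd, e'⟩ := k ⟨q.1, q.2.2⟩
    exact ⟨Submonoid.mul_mem _ hb hd,
      (congrArg₂ (· * ·) e e').trans (Localization.mk_mul _ _ _ _)⟩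

/-- The structure presheaf of monoids on the spectrum of `M`. -/
def structurePresheaf : TopCat.Presheaf CommMonCat.{u} (top M) where
  obj U := CommMonCat.of (sections M U.unop)
  map {U V} i := CommMonCat.ofHom
    { toFun := fun s => ⟨fun p => s.1 (i.unop p), (isLocallyFraction M).res i.unop s.1 s.2⟩
      map_one' := rfl
      map_mul' := fun _ _ => rfl }

theorem structurePresheaf_isSheaf : (structurePresheaf M).IsSheaf := by
  rw [TopCat.Presheaf.isSheaf_iff_isSheaf_comp (forget CommMonCat.{u})]
  exact TopCat.Presheaf.isSheaf_of_iso
    (NatIso.ofComponents (fun _ => Iso.refl _) :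
      (TopCat.subsheafToTypes (isLocallyFraction M)).1 ≅
        structurePresheaf M ⋙ forget CommMonCat.{u})
    (TopCat.subsheafToTypes (isLocallyFraction M)).2

end MonoidSpec

/-- The spectrum of a commutative monoid `M`, a space with a sheaf of commutative monoids. -/
def monoidSpec (M : Type u) [CommMonoid M] :
    AlgebraicGeometry.SheafedSpace CommMonCat.{u} where
  carrier := MonoidSpec.top M
  presheaf := MonoidSpec.structurePresheaf M
  IsSheaf := MonoidSpec.structurePresheaf_isSheaf M

/-! ### Monoid schemes -/

/-- A space with a sheaf of commutative monoids is affine if it is isomorphic to the spectrum of a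
commutative monoid. (Isomorphisms are automatically local.) -/
def IsAffineMonoidSpace (X : AlgebraicGeometry.SheafedSpace CommMonCat.{u}) : Prop :=
  ∃ (M : Type u) (_ : CommMonoid M), Nonempty (X ≅ monoidSpec M)

/-- A morphism of spaces with sheaves of commutative monoids is local if it induces local
homomorphisms on all stalks, i.e. an element of `𝒪_{Y, f x}` is invertible as soon as its image in
`𝒪_{X, x}` is. This is spelled out on representatives of germs: the germ at a point of a section is
invertible if and only if the section is invertible on a neighbourhood of the point. -/
def IsLocalMonoidMorphism {X Y : AlgebraicGeometry.SheafedSpace CommMonCat.{u}} (f : X ⟶ Y) :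
    Prop :=
  ∀ (x : X) (V : Opens Y) (_ : f.hom.base x ∈ V) (s : Y.presheaf.obj (op V)),
    (∃ (U : Opens X) (i : U ⟶ (Opens.map f.hom.base).obj V),
      x ∈ U ∧ IsUnit (X.presheaf.map i.op (f.hom.c.app (op V) s))) →
    ∃ (W : Opens Y) (j : W ⟶ V), f.hom.base x ∈ W ∧ IsUnit (Y.presheaf.map j.op s)

/-- A monoid scheme: a space with a sheaf of commutative monoids which is locally isomorphic to
the spectrum of a commutative monoid. -/
structure MonoidScheme extends AlgebraicGeometry.SheafedSpace CommMonCat.{u} where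
  local_affine : ∀ x : toSheafedSpace, ∃ U : Opens toSheafedSpace, x ∈ U ∧
    IsAffineMonoidSpace (toSheafedSpace.restrict U.isOpenEmbedding)

namespace MonoidScheme

/-- A morphism of monoid schemes: a local morphism of spaces with sheaves of monoids. -/
@[ext]
structure Hom (X Y : MonoidScheme.{u}) where
  hom : X.toSheafedSpace ⟶ Y.toSheafedSpace
  isLocal : IsLocalMonoidMorphism hom

instance : Category MonoidScheme.{u} where
  Hom := Hom
  id X := ⟨𝟙 X.toSheafedSpace, by
    rintro x V hx s ⟨U, i, hU, h⟩
    exact ⟨U, i, hU, h⟩⟩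
  comp f g := ⟨f.hom ≫ g.hom, by
    rintro x V hx s h
    exact g.isLocal _ V hx s (f.isLocal x _ hx (g.hom.hom.c.app (op V) s) h)⟩

/-- A monoid scheme is affine if it is isomorphic to the spectrum of a commutative monoid. -/
def IsAffine (X : MonoidScheme.{u}) : Prop := IsAffineMonoidSpace X.toSheafedSpace

/-- An open subset is affine if the open subscheme on it is affine. -/
def IsAffineOpen (X : MonoidScheme.{u}) (U : Opens X.carrier) : Prop :=
  IsAffineMonoidSpace (X.toSheafedSpace.restrict U.isOpenEmbedding)

/-- A closed immersion of monoid schemes: the preimage of an affine open subset `U` is affine (or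
empty: spectra of monoids without zero are never empty), and the homomorphism from the monoid of
sections on `U` to that on its preimage is surjective. -/
def IsClosedImmersion {X Y : MonoidScheme.{u}} (f : X ⟶ Y) : Prop :=
  ∀ U : Opens Y.carrier, Y.IsAffineOpen U →
    ((Opens.map f.hom.hom.base).obj U = ⊥ ∨
      X.IsAffineOpen ((Opens.map f.hom.hom.base).obj U)) ∧
    Function.Surjective (f.hom.hom.c.app (op U)).hom

/-- A monoid scheme `X` is separated if the diagonal `X ⟶ X × X` is a closed immersion, where
`X × X` is the product in the category of monoid schemes. -/
def IsSeparated (X : MonoidScheme.{u}) : Prop :=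
  ∃ (P : Limits.BinaryFan X X) (hP : Limits.IsLimit P),
    IsClosedImmersion (hP.lift (Limits.BinaryFan.mk (𝟙 X) (𝟙 X)))

end MonoidScheme

/-! ### Cohomology -/

/-- An open cover of a topological space. -/
structure SpaceOpenCover (X : TopCat.{u}) where
  ι : Type u
  U : ι → Opens X
  covers : ∀ x : X, ∃ i, x ∈ U i

namespace SpaceOpenCover

variable {X : TopCat.{u}}

/-- The cover consisting of the whole space. -/
def trivial (X : TopCat.{u}) : SpaceOpenCover X where
  ι := PUnit
  U _ := ⊤
  covers _ := ⟨⟨⟩, Opens.mem_top _⟩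

/-- A refinement of the cover `𝒰` by the cover `𝒱`. -/
structure Refinement (𝒰 𝒱 : SpaceOpenCover X) where
  idx : 𝒱.ι → 𝒰.ι
  le : ∀ k, 𝒱.U k ≤ 𝒰.U (idx k)

/-- The restriction of a cocycle to a refinement. -/
def Refinement.cocycle {𝒰 𝒱 : SpaceOpenCover X} (r : Refinement 𝒰 𝒱)
    {G : (Opens X)ᵒᵖ ⥤ GrpCat.{u}} (γ : PresheafOfGroups.OneCocycle G 𝒰.U) :
    PresheafOfGroups.OneCocycle G 𝒱.U where
  ev i j _ a b := γ.ev (r.idx i) (r.idx j) (a ≫ homOfLE (r.le i)) (b ≫ homOfLE (r.le j))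
  ev_precomp _ _ _ _ φ _ _ := γ.ev_precomp _ _ φ _ _
  ev_trans _ _ _ _ _ _ _ := γ.ev_trans _ _ _ _ _ _

/-- The map `H¹(𝒰, G) → H¹(𝒱, G)` given by a refinement. -/
def Refinement.mapH1 {𝒰 𝒱 : SpaceOpenCover X} (r : Refinement 𝒰 𝒱)
    (G : (Opens X)ᵒᵖ ⥤ GrpCat.{u}) :
    PresheafOfGroups.H1 G 𝒰.U → PresheafOfGroups.H1 G 𝒱.U :=
  Quot.map r.cocycle (by
    rintro γ γ' ⟨α, h⟩
    refine ⟨fun k => G.map (homOfLE (r.le k)).op (α (r.idx k)), fun i j T a b => ?_⟩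
    have := h (r.idx i) (r.idx j) (a ≫ homOfLE (r.le i)) (b ≫ homOfLE (r.le j))
    simpa [Refinement.cocycle] using this)

end SpaceOpenCover

/-- The pointed set `H¹(X, F)` of a sheaf of groups: the colimit over all open covers `𝒰`
of the pointed sets `H¹(𝒰, F)`, along refinements. -/
def NonabelianH1 {X : TopCat.{u}} (F : TopCat.Sheaf GrpCat.{u} X) : Type (u + 1) :=
  Quot (fun a b : (Σ 𝒰 : SpaceOpenCover X, PresheafOfGroups.H1 F.obj 𝒰.U) =>
    ∃ r : SpaceOpenCover.Refinement a.1 b.1, r.mapH1 F.obj a.2 = b.2)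

/-- The distinguished element of `H¹(X, F)`. -/
instance {X : TopCat.{u}} (F : TopCat.Sheaf GrpCat.{u} X) : One (NonabelianH1 F) where
  one := Quot.mk _ ⟨SpaceOpenCover.trivial X, 1⟩

/-- Sheaf cohomology `H^n(X, -)` of sheaves of abelian groups, as a functor: the derived functors
of the functor of global sections, i.e. the groups `Ext^n(ℤ, -)` in the category of sheaves. -/
noncomputable abbrev sheafCohomology (X : TopCat.{u}) (n : ℕ) :
    TopCat.Sheaf AddCommGrpCat.{u} X ⥤ AddCommGrpCat.{u} :=
  Sheaf.functorH (Opens.grothendieckTopology X) n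

/-- The cohomology `H^n(𝒰, -)` of a family of open subsets, as a functor on sheaves of abelian
groups: the cohomology of the Čech complex, which in degree `n` is the product of the groups
`F(U i₀ ∩ ⋯ ∩ U iₙ)` over all `(i₀, …, iₙ)`, with the alternating sums as differentials. -/
noncomputable def coverCohomology {X : TopCat.{u}} {ι : Type u} (U : ι → Opens X) (n : ℕ) :
    TopCat.Sheaf AddCommGrpCat.{u} X ⥤ AddCommGrpCat.{u} :=
  sheafToPresheaf (Opens.grothendieckTopology X) AddCommGrpCat.{u} ⋙ cechComplexFunctor U ⋙
    HomologicalComplex.homologyFunctor _ _ n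

/-! The non-units of a monoid `M` form the largest prime ideal, and the only open set of the
spectrum containing this closed point is the whole spectrum. So an affine open `W` has a point whose
every neighbourhood contains `W`, and an epimorphism of abelian sheaves is surjective on sections
over `W` (`surjective_app_of_epi`). Equivalently, the free abelian sheaf `ℤ_W` is projective.

Part i) follows. If `X` is affine, the constant sheaf `ℤ` is projective, so `Ext^i(ℤ, F) = 0` for `i
≥ 1`. For groups, every open cover has a member equal to `X`, hence is refined by the trivial cover,
on which cocycles are trivial.

For part ii), the free simplicial sheaf on the Čech nerve of a cover is a resolution of `ℤ`: over an
open set inside a member of the cover the nerve has an extra degeneracy. Its terms are direct sums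
of sheaves `ℤ_W`, with `W` a finite intersection of members, and mapping it into `F` gives the Čech
complex of `F`. If all these `W` are affine or empty, the resolution is projective
(`cechResolution`), and Čech cohomology is `Ext^n(ℤ, F)`.

It remains to see that in a separated `X` the intersection of affine opens `U = Spec M` and `V =
Spec N` is affine or empty (`IsSeparated.inf_eq_bot_or_isAffineOpen`). The closed point of `Spec (M
× N)` has an image in `X × X`; an affine neighbourhood of it lying over `U` and `V` has diagonal
preimage exactly `U ∩ V`. This rests on morphisms between spectra being given by monoid
homomorphisms, and on `D(f)` being the spectrum of `M_f`. -/

section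

open Limits

/-! ### Supercompact open sets and vanishing of cohomology -/

/-- An open set is *supercompact* if it is empty or contains a point all of whose open
neighbourhoods contain the whole set. -/
def IsSupercompactOrEmpty {X : TopCat.{u}} (W : Opens X) : Prop :=
  W = ⊥ ∨ ∃ x ∈ W, ∀ V : Opens X, x ∈ V → W ≤ V

namespace IsSupercompactOrEmpty

variable {X : TopCat.{u}} {W : Opens X}

/-- A section of `G` lifts on some neighbourhood of the distinguished point `x`, and that
neighbourhood is all of `W`. Over the empty set a sheaf has only the zero section. -/
theorem surjective_app_of_epi (hW : IsSupercompactOrEmpty W)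
    {F G : TopCat.Sheaf AddCommGrpCat.{u} X} (f : F ⟶ G) (hf : Epi f) :
    Function.Surjective (f.hom.app (op W)) := by
  intro t
  rcases hW with rfl | ⟨x, hx, h⟩
  · have := AddCommGrpCat.subsingleton_of_isZero
      (Limits.IsZero.of_iso (Limits.isZero_zero _)
        (G.isTerminalOfEmpty.uniqueUpToIso Limits.HasZeroObject.zeroIsTerminal))
    exact ⟨0, Subsingleton.elim _ _⟩
  · have hs : Sheaf.IsLocallySurjective f := 
      (Sheaf.isLocallySurjective_iff_epi' AddCommGrpCat f).2 hf
    obtain ⟨V, i, ⟨s, hs⟩, hxV⟩ := hs.imageSieve_mem t x hx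
    obtain rfl : V = W := le_antisymm i.le (h V hxV)
    refine ⟨s, hs.trans ?_⟩
    rw [Subsingleton.elim i (𝟙 _)]
    simp

theorem epi_app_of_epi (hW : IsSupercompactOrEmpty W)
    {F G : TopCat.Sheaf AddCommGrpCat.{u} X} (f : F ⟶ G) (hf : Epi f) :
    Epi (f.hom.app (op W)) :=
  (AddCommGrpCat.epi_iff_surjective _).2 (hW.surjective_app_of_epi f hf)

end IsSupercompactOrEmpty

theorem AddCommGrpCat.projective_uliftInt : Projective (AddCommGrpCat.of (ULift.{u} ℤ)) where
  factors {E Y} f e he := by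
    obtain ⟨y, hy⟩ := (AddCommGrpCat.epi_iff_surjective e).1 he (f ⟨1⟩)
    refine ⟨(AddCommGrpCat.uliftZMultiplesAddEquiv E).symm y, ?_⟩
    apply (AddCommGrpCat.uliftZMultiplesAddEquiv Y).injective
    change e (AddCommGrpCat.uliftZMultiplesAddEquiv E
      ((AddCommGrpCat.uliftZMultiplesAddEquiv E).symm y)) = f ⟨1⟩
    rw [AddEquiv.apply_symm_apply, hy]

/-- The constant sheaf functor is left adjoint to global sections. As the latter preserve
epimorphisms here, the former preserves projectives. -/
theorem projective_constantSheaf_int {X : TopCat.{u}}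
    (hX : IsSupercompactOrEmpty (⊤ : Opens X)) :
    Projective ((constantSheaf (Opens.grothendieckTopology X) AddCommGrpCat.{u}).obj
      (AddCommGrpCat.of (ULift.{u} ℤ))) := by
  have : ((sheafSections (Opens.grothendieckTopology X) AddCommGrpCat.{u}).obj
      (op (⊤ : Opens X))).PreservesEpimorphisms := ⟨fun f hf => hX.epi_app_of_epi f hf⟩
  exact (constantSheafAdj _ AddCommGrpCat.{u} Limits.isTerminalTop).map_projective _
    AddCommGrpCat.projective_uliftInt

theorem subsingleton_sheafCohomology {X : TopCat.{u}}
    (hX : IsSupercompactOrEmpty (⊤ : Opens X)) (F : TopCat.Sheaf AddCommGrpCat.{u} X) (i : ℕ)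
    (hi : 1 ≤ i) : Subsingleton ((sheafCohomology X i).obj F) := by
  obtain ⟨n, rfl⟩ := Nat.exists_eq_add_of_le' hi
  have := projective_constantSheaf_int hX
  exact subsingleton_of_forall_eq 0 fun x ↦ Abelian.Ext.eq_zero_of_projective x

/-- A member of the cover containing `x` is the whole space, so the trivial cover refines the given
one. -/
theorem NonabelianH1.eq_one {X : TopCat.{u}} (F : TopCat.Sheaf GrpCat.{u} X)
    (x : X) (hx : ∀ V : Opens X, x ∈ V → V = ⊤) (c : NonabelianH1 F) : c = 1 := by
  obtain ⟨⟨𝒰, h⟩, rfl⟩ := Quot.exists_rep c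
  obtain ⟨i, hi⟩ := 𝒰.covers x
  let r : SpaceOpenCover.Refinement 𝒰 (SpaceOpenCover.trivial X) :=
    ⟨fun _ => i, fun _ => (hx _ hi).ge⟩
  have key : ∀ a : PresheafOfGroups.H1 F.obj (SpaceOpenCover.trivial X).U, a = 1 := by
    intro a
    obtain ⟨γ, rfl⟩ := Quot.exists_rep a
    -- With one index and one arrow, the cocycle is evaluated only on the diagonal, where it is `1`;
    -- the cochain `1` therefore suffices.
    refine Quot.sound ⟨1, fun i j T a b => ?_⟩
    obtain rfl : i = j := rfl
    obtain rfl : a = b := Subsingleton.elim _ _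
    simp
  exact Quot.sound ⟨r, key _⟩

/-! ### The closed point of a spectrum -/

namespace MonoidPrime

variable {M : Type u} [CommMonoid M]

theorem isTopologicalBasis_basicOpen :
    IsTopologicalBasis (Set.range (basicOpen (M := M))) where
  exists_subset_inter := by
    rintro _ ⟨f, rfl⟩ _ ⟨g, rfl⟩ p ⟨hf, hg⟩
    refine ⟨_, ⟨f * g, rfl⟩, fun h => (p.mem_or_mem' h).elim hf hg, fun q hq => ⟨fun h => hq ?_,
      fun h => hq (q.mul_mem' f h)⟩⟩
    rw [mul_comm]
    exact q.mul_mem' g h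
  sUnion_eq := Set.eq_univ_of_forall fun p => ⟨_, ⟨1, rfl⟩, p.one_notMem'⟩
  eq_generateFrom := rfl

theorem isOpen_basicOpen (f : M) : IsOpen (basicOpen f) :=
  isTopologicalBasis_basicOpen.isOpen ⟨f, rfl⟩

/-- The maximal ideal of a commutative monoid: the set of all non-units. -/
def maximal (M : Type u) [CommMonoid M] : MonoidPrime M where
  carrier := {a | ¬ IsUnit a}
  mul_mem' a x hx h := hx (isUnit_of_mul_isUnit_right h)
  one_notMem' h := h isUnit_one
  mem_or_mem' {x y} h := by
    by_contra! hxy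
    exact h ((not_not.1 hxy.1).mul (not_not.1 hxy.2))

/-- A basic open set `D(f)` containing the ideal of non-units has `f` invertible, and no prime ideal
contains a unit. -/
theorem eq_univ_of_maximal_mem {V : Set (MonoidPrime M)} (hV : IsOpen V) (h : maximal M ∈ V) :
    V = Set.univ := by
  obtain ⟨_, ⟨f, rfl⟩, hf, hfV⟩ := isTopologicalBasis_basicOpen.exists_subset_of_mem_open h hV
  refine Set.eq_univ_of_forall fun p => hfV fun hp => ?_
  obtain ⟨g, hg⟩ := (not_not.1 hf).exists_left_inv
  exact p.one_notMem' (hg ▸ p.mul_mem' g hp)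

end MonoidPrime

theorem IsAffineMonoidSpace.exists_forall_mem_imp_eq_top
    {Y : AlgebraicGeometry.SheafedSpace CommMonCat.{u}} (hY : IsAffineMonoidSpace Y) :
    ∃ y : Y, ∀ V : Opens Y, y ∈ V → V = ⊤ := by
  obtain ⟨M, _, ⟨e⟩⟩ := hY
  let h : Y ≃ₜ MonoidPrime M := TopCat.homeoOfIso
    ((AlgebraicGeometry.SheafedSpace.forget _).mapIso e)
  refine ⟨h.symm (MonoidPrime.maximal M), fun V hV => ?_⟩
  have := MonoidPrime.eq_univ_of_maximal_mem (V := h.symm ⁻¹' V)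
    (V.isOpen.preimage h.symm.continuous) hV
  ext y
  simpa using this.ge (Set.mem_univ (h y))

theorem MonoidScheme.IsAffineOpen.isSupercompactOrEmpty {X : MonoidScheme.{u}}
    {U : Opens X.carrier} (hU : X.IsAffineOpen U) : IsSupercompactOrEmpty U := by
  obtain ⟨y, hy⟩ := IsAffineMonoidSpace.exists_forall_mem_imp_eq_top hU
  refine Or.inr ⟨y.1, y.2, fun V hV x hx => ?_⟩
  have := hy ((Opens.map U.inclusion').obj V) hV
  exact (this.ge (Opens.mem_top ⟨x, hx⟩) :)

/-! ### Free abelian presheaves on formal coproducts -/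

namespace CategoryTheory.Limits.FormalCoproduct

section

variable (C : Type u) [SmallCategory C]

/-- The presheaf of sets represented by a formal coproduct, sending `V` to the set of
morphisms from `V` to the formal coproduct. -/
def restrictedYoneda : FormalCoproduct.{u} C ⥤ Cᵒᵖ ⥤ Type u :=
  yoneda ⋙ (Functor.whiskeringLeft _ _ _).obj (incl.{u} C).op

/-- The free abelian presheaf on a formal coproduct. -/
noncomputable def freePresheaf : FormalCoproduct.{u} C ⥤ Cᵒᵖ ⥤ AddCommGrpCat.{u} :=
  restrictedYoneda C ⋙ (Functor.whiskeringRight _ _ _).obj AddCommGrpCat.free.{u}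

variable {C}

/-- The basis element of the free abelian presheaf given by a morphism. -/
def freePresheafOf {E : FormalCoproduct.{u} C} {V : C} (x : (incl.{u} C).obj V ⟶ E) :
    ((freePresheaf C).obj E).obj (op V) :=
  FreeAbelianGroup.of x

theorem freePresheafOf_map {E : FormalCoproduct.{u} C} {V W : C} (a : W ⟶ V)
    (x : (incl.{u} C).obj V ⟶ E) :
    ((freePresheaf C).obj E).map a.op (freePresheafOf x) =
      freePresheafOf ((incl.{u} C).map a ≫ x) :=
  FreeAbelianGroup.map_of_apply _

theorem freePresheaf_map_app_of {E E' : FormalCoproduct.{u} C} {V : C} (g : E ⟶ E')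
    (x : (incl.{u} C).obj V ⟶ E) :
    ((freePresheaf C).map g).app (op V) (freePresheafOf x) = freePresheafOf (x ≫ g) :=
  FreeAbelianGroup.map_of_apply _

/-- The tautological section of the free abelian presheaf. -/
noncomputable def freePresheafGen (E : FormalCoproduct.{u} C) (i : E.I) :
    ((freePresheaf C).obj E).obj (op (E.obj i)) :=
  freePresheafOf (Hom.fromIncl i (𝟙 _))

/-- This is the Yoneda principle: a morphism from `V` picks an index `i` and an arrow to `E.obj i`,
so every basis element is a restriction of a tautological section. -/
theorem freePresheafOf_eq {E : FormalCoproduct.{u} C} {V : C} (x : (incl.{u} C).obj V ⟶ E) :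
    freePresheafOf x =
      ((freePresheaf C).obj E).map (x.asSigma.2).op (freePresheafGen E (x.asSigma.1)) := by
  rw [freePresheafGen, freePresheafOf_map]
  congr 1
  exact hom_ext rfl fun _ => (Category.comp_id _).trans (Category.comp_id _).symm

theorem freePresheaf_hom_ext {E : FormalCoproduct.{u} C} {F : Cᵒᵖ ⥤ AddCommGrpCat.{u}}
    {f g : (freePresheaf C).obj E ⟶ F}
    (h : ∀ i, f.app _ (freePresheafGen E i) = g.app _ (freePresheafGen E i)) : f = g := by
  ext V : 2
  apply AddCommGrpCat.hom_ext
  apply FreeAbelianGroup.lift_ext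
  intro (x : (incl.{u} C).obj V.unop ⟶ E)
  change f.app (op V.unop) (freePresheafOf x) = g.app (op V.unop) (freePresheafOf x)
  rw [freePresheafOf_eq, NatTrans.naturality_apply, NatTrans.naturality_apply, h]

/-- The morphism from the free abelian presheaf given by a family of sections. -/
noncomputable def freePresheafDesc {E : FormalCoproduct.{u} C} {F : Cᵒᵖ ⥤ AddCommGrpCat.{u}}
    (s : ∀ i, F.obj (op (E.obj i))) : (freePresheaf C).obj E ⟶ F where
  app V := AddCommGrpCat.ofHom (FreeAbelianGroup.lift fun x =>
    F.map (x.asSigma.2).op (s (x.asSigma.1)))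
  naturality V W a := by
    apply AddCommGrpCat.hom_ext
    apply FreeAbelianGroup.lift_ext
    intro (x : (incl.{u} C).obj V.unop ⟶ E)
    have h : ∀ {V : C} (x : (incl.{u} C).obj V ⟶ E),
        FreeAbelianGroup.lift (fun x : (incl.{u} C).obj V ⟶ E =>
          F.map (x.asSigma.2).op (s (x.asSigma.1)))
          (freePresheafOf x) = F.map (x.asSigma.2).op (s (x.asSigma.1)) :=
      fun x => FreeAbelianGroup.lift_apply_of _ _
    refine (congrArg _ (freePresheafOf_map a.unop x)).trans ((h _).trans ?_)
    refine Eq.trans ?_ (congrArg (F.map a) (h x)).symm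
    exact ConcreteCategory.congr_hom (F.map_comp x.asSigma.2.op a) (s x.asSigma.1)

theorem freePresheafDesc_gen {E : FormalCoproduct.{u} C} {F : Cᵒᵖ ⥤ AddCommGrpCat.{u}}
    (s : ∀ i, F.obj (op (E.obj i))) (i : E.I) :
    (freePresheafDesc s).app _ (freePresheafGen E i) = s i := by
  refine (FreeAbelianGroup.lift_apply_of _ _).trans ?_
  change F.map (𝟙 _) (s i) = s i
  simp

/-- The projections from the value of a presheaf on a formal coproduct. -/
noncomputable def evalOpπ (E : FormalCoproduct.{u} C) (F : Cᵒᵖ ⥤ AddCommGrpCat.{u}) (i : E.I) :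
    ((evalOp C AddCommGrpCat.{u}).obj F).obj (op E) ⟶ F.obj (op (E.obj i)) :=
  Pi.π (fun i => F.obj (op (E.obj i))) i

theorem evalOp_map_app_π {E : FormalCoproduct.{u} C} {F G : Cᵒᵖ ⥤ AddCommGrpCat.{u}} (φ : F ⟶ G)
    (i : E.I) : ((evalOp C AddCommGrpCat.{u}).map φ).app (op E) ≫ evalOpπ E G i =
      evalOpπ E F i ≫ φ.app _ :=
  Pi.map_π (fun i : E.I => φ.app (op (E.obj i))) i

theorem evalOp_obj_map_π {E E' : FormalCoproduct.{u} C} {F : Cᵒᵖ ⥤ AddCommGrpCat.{u}}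
    (g : E' ⟶ E) (i : E'.I) : ((evalOp C AddCommGrpCat.{u}).obj F).map g.op ≫ evalOpπ E' F i =
      evalOpπ E F (g.f i) ≫ F.map (g.φ i).op :=
  Pi.lift_π _ _

theorem evalOp_ext {E : FormalCoproduct.{u} C} {F : Cᵒᵖ ⥤ AddCommGrpCat.{u}}
    {x y : ((evalOp C AddCommGrpCat.{u}).obj F).obj (op E)}
    (h : ∀ i, evalOpπ E F i x = evalOpπ E F i y) : x = y :=
  Concrete.limit_ext _ _ _ fun ⟨i⟩ => h i

/-- Evaluation of a morphism from a free abelian presheaf at a tautological section. -/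
noncomputable def freePresheafEval (E : FormalCoproduct.{u} C) (F : Cᵒᵖ ⥤ AddCommGrpCat.{u})
    (i : E.I) : AddCommGrpCat.of ((freePresheaf C).obj E ⟶ F) ⟶ F.obj (op (E.obj i)) :=
  AddCommGrpCat.ofHom
    { toFun := fun f => f.app _ (freePresheafGen E i)
      map_zero' := rfl
      map_add' := fun _ _ => rfl }

/-- Morphisms from the free abelian presheaf on a formal coproduct are sections on that formal
coproduct. -/
noncomputable def freePresheafHom (E : FormalCoproduct.{u} C) (F : Cᵒᵖ ⥤ AddCommGrpCat.{u}) :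
    ((freePresheaf C).obj E ⟶ F) →+ ((evalOp C AddCommGrpCat.{u}).obj F).obj (op E) :=
  (Pi.lift (freePresheafEval E F)).hom

theorem π_freePresheafHom (E : FormalCoproduct.{u} C) (F : Cᵒᵖ ⥤ AddCommGrpCat.{u})
    (f : (freePresheaf C).obj E ⟶ F) (i : E.I) :
    evalOpπ E F i (freePresheafHom E F f) = f.app _ (freePresheafGen E i) :=
  ConcreteCategory.congr_hom (Pi.lift_π (freePresheafEval E F) i) f

/-- Yoneda combined with the free-forgetful adjunction: a morphism is the same as a free choice of
images of the tautological sections. -/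
theorem freePresheafHom_bijective (E : FormalCoproduct.{u} C) (F : Cᵒᵖ ⥤ AddCommGrpCat.{u}) :
    Function.Bijective (freePresheafHom E F) := by
  refine ⟨fun f g h => freePresheaf_hom_ext fun i => ?_, fun x =>
    ⟨freePresheafDesc fun i => evalOpπ E F i x, evalOp_ext fun i => ?_⟩⟩
  · rw [← π_freePresheafHom, h, π_freePresheafHom]
  · rw [π_freePresheafHom, freePresheafDesc_gen]

theorem freePresheafHom_comp {E : FormalCoproduct.{u} C} {F G : Cᵒᵖ ⥤ AddCommGrpCat.{u}}
    (f : (freePresheaf C).obj E ⟶ F) (φ : F ⟶ G) :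
    freePresheafHom E G (f ≫ φ) =
      ((evalOp C AddCommGrpCat.{u}).map φ).app (op E) (freePresheafHom E F f) := by
  refine evalOp_ext fun i => ?_
  rw [π_freePresheafHom, ← ConcreteCategory.comp_apply, evalOp_map_app_π,
    ConcreteCategory.comp_apply, π_freePresheafHom]
  rfl

/-- Naturality in the formal coproduct; applied to the faces of the Čech object it produces the
cofaces of the Čech complex. -/
theorem freePresheafHom_map_comp {E E' : FormalCoproduct.{u} C} {F : Cᵒᵖ ⥤ AddCommGrpCat.{u}}
    (g : E' ⟶ E) (f : (freePresheaf C).obj E ⟶ F) :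
    freePresheafHom E' F ((freePresheaf C).map g ≫ f) =
      ((evalOp C AddCommGrpCat.{u}).obj F).map g.op (freePresheafHom E F f) := by
  refine evalOp_ext fun i => ?_
  rw [π_freePresheafHom, ← ConcreteCategory.comp_apply, evalOp_obj_map_π,
    ConcreteCategory.comp_apply, π_freePresheafHom, ← NatTrans.naturality_apply]
  change f.app _ (((freePresheaf C).map g).app _ (freePresheafGen E' i)) = _
  rw [freePresheafGen, freePresheaf_map_app_of, freePresheafOf_eq]
  change f.app _ (((freePresheaf C).obj E).map (𝟙 _ ≫ g.φ i).op (freePresheafGen E (g.f i))) = _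
  rw [Category.id_comp]

end

end CategoryTheory.Limits.FormalCoproduct

/-! ### The free simplicial presheaf on the Čech nerve and its contraction -/

namespace CategoryTheory.Limits.FormalCoproduct

section

variable {C : Type u} [SmallCategory C]

/-- The augmentation of the free abelian presheaf on a formal coproduct. -/
noncomputable def freePresheafAug (E : FormalCoproduct.{u} C) :
    (freePresheaf C).obj E ⟶ (Functor.const _).obj (AddCommGrpCat.of (ULift.{u} ℤ)) :=
  freePresheafDesc (F := (Functor.const _).obj (AddCommGrpCat.of (ULift.{u} ℤ)))
    fun _ => ULift.up (1 : ℤ)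

theorem freePresheafAug_of {E : FormalCoproduct.{u} C} {V : C} (x : (incl.{u} C).obj V ⟶ E) :
    (freePresheafAug E).app (op V) (freePresheafOf x) = ULift.up (1 : ℤ) :=
  FreeAbelianGroup.lift_apply_of _ _

theorem freePresheaf_map_aug {E E' : FormalCoproduct.{u} C} (g : E ⟶ E') :
    (freePresheaf C).map g ≫ freePresheafAug E' = freePresheafAug E := by
  refine freePresheaf_hom_ext fun i => ?_
  rw [freePresheafGen, freePresheafAug_of]
  change (freePresheafAug E').app _ (((freePresheaf C).map g).app _ (freePresheafOf _)) = _
  rw [freePresheaf_map_app_of, freePresheafAug_of]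

theorem freePresheaf_app_hom_ext {E : FormalCoproduct.{u} C} {V : C} {G : AddCommGrpCat.{u}}
    {f g : ((freePresheaf C).obj E).obj (op V) ⟶ G}
    (h : ∀ x : (incl.{u} C).obj V ⟶ E, f (freePresheafOf x) = g (freePresheafOf x)) : f = g :=
  AddCommGrpCat.hom_ext (FreeAbelianGroup.lift_ext _ _ h)

/-- The homomorphism between values of free abelian presheaves given by a map of bases. -/
noncomputable def freePresheafAppMap {E E' : FormalCoproduct.{u} C} {V : C}
    (t : ((incl.{u} C).obj V ⟶ E) → ((incl.{u} C).obj V ⟶ E')) :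
    ((freePresheaf C).obj E).obj (op V) ⟶ ((freePresheaf C).obj E').obj (op V) :=
  AddCommGrpCat.ofHom (FreeAbelianGroup.lift fun x => freePresheafOf (t x))

theorem freePresheafAppMap_of {E E' : FormalCoproduct.{u} C} {V : C}
    (t : ((incl.{u} C).obj V ⟶ E) → ((incl.{u} C).obj V ⟶ E')) (x : (incl.{u} C).obj V ⟶ E) :
    freePresheafAppMap t (freePresheafOf x) = freePresheafOf (t x) :=
  FreeAbelianGroup.lift_apply_of _ _

variable {U : FormalCoproduct.{u} C}

theorem hom_power_ext {E : FormalCoproduct.{u} C} {α : Type} [HasProductsOfShape α C]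
    {x y : E ⟶ U.power α} (h : ∀ a, x ≫ U.powerπ a = y ≫ U.powerπ a) : x = y :=
  (U.isLimitPowerFan α).hom_ext fun ⟨a⟩ => h a

/-- The morphism to a power with given components. -/
noncomputable def powerLift {E : FormalCoproduct.{u} C} {α : Type} [HasProductsOfShape α C]
    (x : α → (E ⟶ U)) : E ⟶ U.power α :=
  Fan.IsLimit.lift (U.isLimitPowerFan α) x

theorem powerLift_π {E : FormalCoproduct.{u} C} {α : Type} [HasProductsOfShape α C]
    (x : α → (E ⟶ U)) (a : α) : powerLift x ≫ U.powerπ a = x a :=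
  Fan.IsLimit.fac (U.isLimitPowerFan α) x a

theorem powerLift_mapPower {E : FormalCoproduct.{u} C} {α β : Type} [HasProductsOfShape α C]
    [HasProductsOfShape β C] (x : α → (E ⟶ U)) (f : β → α) :
    powerLift x ≫ U.mapPower f = powerLift (x ∘ f) :=
  hom_power_ext fun b => by
    rw [Category.assoc, mapPower_π, powerLift_π, powerLift_π, Function.comp]

end

section

variable {C : Type u} [SmallCategory C] [HasFiniteProducts C] (U : FormalCoproduct.{u} C)

/-- The free simplicial abelian presheaf on the Čech object of a formal coproduct, with its
augmentation to the constant presheaf. -/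
noncomputable def freeCech : SimplicialObject.Augmented (Cᵒᵖ ⥤ AddCommGrpCat.{u}) where
  left := ((SimplicialObject.whiskering _ _).obj (freePresheaf C)).obj U.cech
  right := (Functor.const _).obj (AddCommGrpCat.of (ULift.{u} ℤ))
  hom :=
    { app := fun n => freePresheafAug (U.cech.obj n)
      naturality := fun _ _ g =>
        (freePresheaf_map_aug (U.cech.map g)).trans (Category.comp_id _).symm }

variable {U}

theorem freeCech_map_of {V : C} {m n : ℕ} (f : SimplexCategory.mk m ⟶ SimplexCategory.mk n)
    (x : (incl.{u} C).obj V ⟶ U.power (Fin (n + 1))) :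
    (U.freeCech.left.map f.op).app (op V) (freePresheafOf x) =
      freePresheafOf (x ≫ U.mapPower f.toOrderHom.toFun) :=
  freePresheaf_map_app_of _ _

theorem freeCech_map_appMap_of {E : FormalCoproduct.{u} C} {V : C} {m n : ℕ}
    (f : SimplexCategory.mk m ⟶ SimplexCategory.mk n)
    (t : ((incl.{u} C).obj V ⟶ E) → ((incl.{u} C).obj V ⟶ U.power (Fin (n + 1))))
    (x : (incl.{u} C).obj V ⟶ E) :
    (U.freeCech.left.map f.op).app (op V) (freePresheafAppMap t (freePresheafOf x)) =
      freePresheafOf (t x ≫ U.mapPower f.toOrderHom.toFun) := by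
  rw [freePresheafAppMap_of]
  exact freeCech_map_of f (t x)

theorem freePresheafAppMap_freeCech_map_of {E : FormalCoproduct.{u} C} {V : C} {m n : ℕ}
    (f : SimplexCategory.mk m ⟶ SimplexCategory.mk n)
    (t : ((incl.{u} C).obj V ⟶ U.power (Fin (m + 1))) → ((incl.{u} C).obj V ⟶ E))
    (x : (incl.{u} C).obj V ⟶ U.power (Fin (n + 1))) :
    freePresheafAppMap t ((U.freeCech.left.map f.op).app (op V) (freePresheafOf x)) =
      freePresheafOf (t (x ≫ U.mapPower f.toOrderHom.toFun)) :=
  (congrArg _ (freeCech_map_of f x)).trans (freePresheafAppMap_of _ _)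

/-- Prepending a component to a morphism to a power. -/
noncomputable def powerCons {E : FormalCoproduct.{u} C} (d : E ⟶ U) (n : ℕ)
    (x : E ⟶ U.power (Fin (n + 1))) : E ⟶ U.power (Fin (n + 2)) :=
  powerLift (Fin.cases d fun j => x ≫ U.powerπ j)

theorem _root_.AddCommGrpCat.hom_ext_of_uliftInt {G : AddCommGrpCat.{u}}
    {f g : AddCommGrpCat.of (ULift.{u} ℤ) ⟶ G} (h : f (ULift.up (1 : ℤ)) = g (ULift.up (1 : ℤ))) :
    f = g :=
  (AddCommGrpCat.uliftZMultiplesAddEquiv G).injective h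

theorem _root_.AddCommGrpCat.uliftZMultiplesAddEquiv_symm_one {G : AddCommGrpCat.{u}} (g : G) :
    (AddCommGrpCat.uliftZMultiplesAddEquiv G).symm g (ULift.up (1 : ℤ)) = g :=
  (AddCommGrpCat.uliftZMultiplesAddEquiv G).apply_symm_apply g

/-- On an object with a morphism to the formal coproduct, the free simplicial abelian presheaf on
the Čech object has an extra degeneracy. -/
noncomputable def extraDegeneracyFreeCech {V : C} (d : (incl.{u} C).obj V ⟶ U) :
    (((SimplicialObject.Augmented.whiskering _ _).obj
      ((evaluation _ _).obj (op V))).obj U.freeCech).ExtraDegeneracy where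
  -- A morphism from `V` to a power of `U` is a tuple of morphisms to `U`, and any tuple is allowed.
  -- The contraction sends `1` to the vertex `d` and puts `d` in front of every tuple.
  s' := (AddCommGrpCat.uliftZMultiplesAddEquiv _).symm
    (freePresheafOf (E := U.power (Fin 1)) (powerLift fun _ => d))
  s n := freePresheafAppMap (powerCons d n)
  s'_comp_ε := by
    refine AddCommGrpCat.hom_ext_of_uliftInt ?_
    refine (congrArg (fun y => (freePresheafAug (U.power (Fin 1))).app (op V) y)
      (AddCommGrpCat.uliftZMultiplesAddEquiv_symm_one
        (freePresheafOf (E := U.power (Fin 1)) (powerLift fun _ => d)))).trans ?_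
    exact freePresheafAug_of (E := U.power (Fin 1)) _
  s₀_comp_δ₁ := by
    refine freePresheaf_app_hom_ext (E := U.power (Fin 1)) fun x => ?_
    refine (freeCech_map_appMap_of (SimplexCategory.δ 1) (powerCons d 0) x).trans ?_
    refine Eq.trans ?_ (congrArg (fun y : ULift.{u} ℤ => (AddCommGrpCat.uliftZMultiplesAddEquiv
      (((freePresheaf C).obj (U.power (Fin 1))).obj (op V))).symm
        (freePresheafOf (powerLift fun _ => d)) y) (freePresheafAug_of x)).symm
    refine Eq.trans ?_ (AddCommGrpCat.uliftZMultiplesAddEquiv_symm_one _).symm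
    rw [powerCons, powerLift_mapPower]
    congr 2
    ext a : 1
    obtain rfl : a = (0 : Fin 1) := Subsingleton.elim (α := Fin 1) _ _
    rfl
  s_comp_δ₀ n := by
    refine freePresheaf_app_hom_ext (E := U.power (Fin (n + 1))) fun x => ?_
    refine (freeCech_map_appMap_of (SimplexCategory.δ 0) (powerCons d n) x).trans ?_
    refine congrArg freePresheafOf (hom_power_ext (α := Fin (n + 1)) fun a => ?_)
    rw [powerCons, powerLift_mapPower, powerLift_π]
    rfl
  s_comp_δ n i := by
    refine freePresheaf_app_hom_ext (E := U.power (Fin (n + 1 + 1))) fun x => ?_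
    refine (freeCech_map_appMap_of (SimplexCategory.δ i.succ) (powerCons d (n + 1)) x).trans ?_
    refine Eq.trans ?_
      (freePresheafAppMap_freeCech_map_of (SimplexCategory.δ i) (powerCons d n) x).symm
    refine congrArg freePresheafOf (hom_power_ext (α := Fin (n + 2)) fun a => ?_)
    rw [powerCons, powerCons, powerLift_mapPower, powerLift_π, powerLift_π]
    -- Index `0` carries the prepended `d`; the successors carry the original tuple.
    induction a using Fin.cases <;> simp [SimplexCategory.δ]
  s_comp_σ n i := by
    refine freePresheaf_app_hom_ext (E := U.power (Fin (n + 1))) fun x => ?_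
    refine (freeCech_map_appMap_of (SimplexCategory.σ i.succ) (powerCons d n) x).trans ?_
    refine Eq.trans ?_
      (freePresheafAppMap_freeCech_map_of (SimplexCategory.σ i) (powerCons d (n + 1)) x).symm
    refine congrArg freePresheafOf (hom_power_ext (α := Fin (n + 3)) fun a => ?_)
    rw [powerCons, powerCons, powerLift_mapPower, powerLift_π, powerLift_π]
    induction a using Fin.cases <;> simp [SimplexCategory.σ]

end

end CategoryTheory.Limits.FormalCoproduct

/-! ### Augmented simplicial objects and additive functors -/

namespace CategoryTheory

open AlgebraicTopology

section

variable {C D : Type*} [Category* C] [Category* D] [Abelian C] [Abelian D]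

/-- Additive functors commute with the formation of alternating face map complexes. -/
noncomputable def Functor.mapAlternatingFaceMapComplexIso (F : C ⥤ D) [F.Additive]
    (S : SimplicialObject C) :
    (F.mapHomologicalComplex _).obj ((alternatingFaceMapComplex C).obj S) ≅
      (alternatingFaceMapComplex D).obj (((SimplicialObject.whiskering C D).obj F).obj S) :=
  HomologicalComplex.Hom.isoOfComponents (fun _ => Iso.refl _) (by
    rintro i j (rfl : j + 1 = i)
    simp [AlternatingFaceMapComplex.objD, Functor.map_sum]
    exact (Category.id_comp _).trans (Category.comp_id _).symm)

/-- The augmentation of the alternating face map complex of an augmented simplicial object. -/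
noncomputable def SimplicialObject.Augmented.complexAug (S : SimplicialObject.Augmented C) :
    (alternatingFaceMapComplex C).obj S.left ⟶ (ChainComplex.single₀ C).obj S.right :=
  AlternatingFaceMapComplex.ε.app S

theorem SimplicialObject.Augmented.complexAug_f_zero (S : SimplicialObject.Augmented C) :
    S.complexAug.f 0 = S.hom.app (op (.mk 0)) :=
  AlternatingFaceMapComplex.ε_app_f_zero S

/-- The comparison of `Functor.mapAlternatingFaceMapComplexIso` for augmented objects. -/
noncomputable def Functor.mapComplexAugSourceIso (F : C ⥤ D) [F.Additive]
    (S : SimplicialObject.Augmented C) :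
    (F.mapHomologicalComplex _).obj ((alternatingFaceMapComplex C).obj S.left) ≅
      (alternatingFaceMapComplex D).obj
        (((SimplicialObject.Augmented.whiskering C D).obj F).obj S).left :=
  F.mapAlternatingFaceMapComplexIso S.left

/-- The comparison of the targets of the augmentations. -/
noncomputable def Functor.mapComplexAugTargetIso (F : C ⥤ D) [F.Additive]
    (S : SimplicialObject.Augmented C) :
    (F.mapHomologicalComplex _).obj ((ChainComplex.single₀ C).obj S.right) ≅
      (ChainComplex.single₀ D).obj
        (((SimplicialObject.Augmented.whiskering C D).obj F).obj S).right :=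
  (HomologicalComplex.singleMapHomologicalComplex F (ComplexShape.down ℕ) 0).app S.right

/-- The target is concentrated in degree `0`, so only that degree has to be compared. -/
theorem Functor.map_complexAug (F : C ⥤ D) [F.Additive] (S : SimplicialObject.Augmented C) :
    (F.mapHomologicalComplex _).map S.complexAug ≫ (F.mapComplexAugTargetIso S).hom =
      (F.mapComplexAugSourceIso S).hom ≫
        (((SimplicialObject.Augmented.whiskering C D).obj F).obj S).complexAug := by
  apply HomologicalComplex.to_single_hom_ext
  have h1 := HomologicalComplex.singleMapHomologicalComplex_hom_app_self F (ComplexShape.down ℕ) 0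
    S.right
  refine (congrArg (F.map (S.complexAug.f 0) ≫ ·) h1).trans ?_
  refine Eq.trans ?_ (congrArg (𝟙 (F.obj (S.left.obj (op (.mk 0)))) ≫ ·)
    (SimplicialObject.Augmented.complexAug_f_zero
      (((SimplicialObject.Augmented.whiskering C D).obj F).obj S))).symm
  rw [SimplicialObject.Augmented.complexAug_f_zero]
  refine Eq.trans ?_ (Category.id_comp _).symm
  simp
  exact (Category.comp_id _).symm

/-- An extra degeneracy makes the augmentation a homotopy equivalence. It is required only after
applying `F`, since for the Čech nerve it exists only after evaluation at small open sets. -/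
theorem Functor.quasiIso_map_complexAug (F : C ⥤ D) [F.Additive]
    (S : SimplicialObject.Augmented C)
    (h : (((SimplicialObject.Augmented.whiskering C D).obj F).obj S).ExtraDegeneracy) :
    QuasiIso ((F.mapHomologicalComplex _).map S.complexAug) := by
  have h1 : QuasiIso ((F.mapComplexAugSourceIso S).hom ≫
      (((SimplicialObject.Augmented.whiskering C D).obj F).obj S).complexAug) := by
    have h2 : QuasiIso (((SimplicialObject.Augmented.whiskering C D).obj F).obj S).complexAug :=
      h.homotopyEquiv.quasiIso_hom
    exact quasiIso_comp _ _
  rw [← F.map_complexAug] at h1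
  exact quasiIso_of_comp_right _ (F.mapComplexAugTargetIso S).hom

/-- Serves for two exact functors: evaluation of presheaves at an open set, and sheafification. -/
theorem Functor.quasiIsoAt_mapHomologicalComplex_iff {ι : Type*} {c : ComplexShape ι} (F : C ⥤ D)
    [F.Additive] [F.PreservesHomology] {K L : HomologicalComplex C c} (φ : K ⟶ L) (i : ι) :
    QuasiIsoAt ((F.mapHomologicalComplex _).map φ) i ↔
      IsIso (F.map (HomologicalComplex.homologyMap φ i)) := by
  rw [quasiIsoAt_iff_isIso_homologyMap]
  exact (MorphismProperty.isomorphisms D).arrow_mk_iso_iff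
    (Arrow.isoMk (ShortComplex.mapHomologyIso (K.sc i) F) (ShortComplex.mapHomologyIso (L.sc i) F)
      (ShortComplex.mapHomologyIso_hom_naturality
        ((HomologicalComplex.shortComplexFunctor C c i).map φ) F).symm)

end

/-! ### The Čech resolution of the constant sheaf -/

namespace Limits.FormalCoproduct

variable {X : TopCat.{u}} (U : FormalCoproduct.{u} (Opens X))

/-- Over an open set contained in a member of the cover the augmentation is a quasi-isomorphism by
the extra degeneracy. Every point of an open set has such a neighbourhood inside it, so the map on
homology presheaves is locally bijective. -/
theorem W_homologyMap_complexAug (hU : ∀ x : X, ∃ i, x ∈ U.obj i) (n : ℕ) :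
    (Opens.grothendieckTopology X).W (HomologicalComplex.homologyMap
      U.freeCech.complexAug n) := by
  have key : ∀ (V : Opens X) (i : U.I), V ≤ U.obj i →
      Function.Bijective ((HomologicalComplex.homologyMap
        U.freeCech.complexAug n).app (op V)) := by
    intro V i hV
    have : QuasiIso (((evaluation _ _).obj (op V)).mapHomologicalComplex _ |>.map
      U.freeCech.complexAug) :=
      Functor.quasiIso_map_complexAug _ _ (extraDegeneracyFreeCech (Hom.fromIncl i (homOfLE hV)))
    have := (Functor.quasiIsoAt_mapHomologicalComplex_iff _ _ n).1 (this.quasiIsoAt n)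
    exact ConcreteCategory.bijective_of_isIso ((((evaluation _ _).obj (op V))).map _)
  rw [GrothendieckTopology.W_iff_isLocallyBijective]
  refine ⟨⟨fun {V} x y h p hp => ?_⟩, ⟨fun {V} s p hp => ?_⟩⟩
  · obtain ⟨i, hi⟩ := hU p
    refine ⟨V.unop ⊓ U.obj i, homOfLE inf_le_left, ?_, ⟨hp, hi⟩⟩
    refine (key _ i inf_le_right).1 ?_
    refine (NatTrans.naturality_apply _ _ x).trans ?_
    exact (congrArg _ h).trans (NatTrans.naturality_apply _ _ y).symm
  · obtain ⟨i, hi⟩ := hU p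
    refine ⟨V ⊓ U.obj i, homOfLE inf_le_left, ?_, ⟨hp, hi⟩⟩
    exact (key _ i inf_le_right).2 _

/-- Sheafification commutes with homology and inverts locally bijective maps. -/
theorem quasiIso_sheafification_complexAug (hU : ∀ x : X, ∃ i, x ∈ U.obj i) :
    QuasiIso (((presheafToSheaf (Opens.grothendieckTopology X) AddCommGrpCat.{u}).mapHomologicalComplex _).map
      U.freeCech.complexAug) :=
  ⟨fun n => (Functor.quasiIsoAt_mapHomologicalComplex_iff _ _ n).2
    (((Opens.grothendieckTopology X).W_iff _).1 (W_homologyMap_complexAug U hU n))⟩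

/-- The sheaf of abelian groups freely generated by a formal coproduct of open sets. -/
noncomputable def freeSheaf (X : TopCat.{u}) :
    FormalCoproduct.{u} (Opens X) ⥤ Sheaf (Opens.grothendieckTopology X) AddCommGrpCat.{u} :=
  freePresheaf (Opens X) ⋙ presheafToSheaf (Opens.grothendieckTopology X) AddCommGrpCat.{u}

/-- Morphisms from the free abelian sheaf on a formal coproduct of open sets are sections. -/
noncomputable def freeSheafHom (E : FormalCoproduct.{u} (Opens X))
    (F : Sheaf (Opens.grothendieckTopology X) AddCommGrpCat.{u}) :
    ((freeSheaf.{u} X).obj E ⟶ F) ≃+ ((evalOp (Opens X) AddCommGrpCat.{u}).obj F.obj).obj (op E) :=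
  ((sheafificationAdjunction (Opens.grothendieckTopology X) AddCommGrpCat.{u}).homAddEquiv
    _ _).trans (AddEquiv.ofBijective _ (freePresheafHom_bijective E F.obj))

theorem freeSheafHom_comp {E : FormalCoproduct.{u} (Opens X)}
    {F G : Sheaf (Opens.grothendieckTopology X) AddCommGrpCat.{u}}
    (f : (freeSheaf.{u} X).obj E ⟶ F) (φ : F ⟶ G) :
    freeSheafHom E G (f ≫ φ) =
      ((evalOp (Opens X) AddCommGrpCat.{u}).map φ.hom).app (op E) (freeSheafHom E F f) := by
  refine Eq.trans ?_ (freePresheafHom_comp _ _)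
  exact congrArg (freePresheafHom E G.obj) (Adjunction.homEquiv_naturality_right _ _ _)

theorem freeSheafHom_map_comp {E E' : FormalCoproduct.{u} (Opens X)}
    {F : Sheaf (Opens.grothendieckTopology X) AddCommGrpCat.{u}} (g : E' ⟶ E)
    (f : (freeSheaf.{u} X).obj E ⟶ F) :
    freeSheafHom E' F ((freeSheaf.{u} X).map g ≫ f) =
      ((evalOp (Opens X) AddCommGrpCat.{u}).obj F.obj).map g.op (freeSheafHom E F f) := by
  refine Eq.trans ?_ (freePresheafHom_map_comp _ _)
  exact congrArg (freePresheafHom E' F.obj) (Adjunction.homEquiv_naturality_left _ _ _)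

/-- A morphism out of this sheaf is a family of sections over the `E.obj i`, and each of these can
be lifted along an epimorphism separately. -/
theorem projective_freeSheaf (E : FormalCoproduct.{u} (Opens X))
    (hE : ∀ i, IsSupercompactOrEmpty (E.obj i)) : Projective ((freeSheaf.{u} X).obj E) where
  factors {F G} f e he := by
    choose s hs using fun i => (hE i).surjective_app_of_epi e he
      (evalOpπ E G.obj i (freeSheafHom E G f))
    obtain ⟨t, ht⟩ := (freePresheafHom_bijective E F.obj).2
      (freePresheafHom E F.obj (freePresheafDesc s))
    refine ⟨(freeSheafHom E F).symm (freePresheafHom E F.obj (freePresheafDesc s)),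
      (freeSheafHom E G).injective ?_⟩
    rw [freeSheafHom_comp, AddEquiv.apply_symm_apply]
    refine evalOp_ext fun i => ?_
    rw [← ConcreteCategory.comp_apply, evalOp_map_app_π, ConcreteCategory.comp_apply,
      π_freePresheafHom, freePresheafDesc_gen, hs]

variable (hU : ∀ x : X, ∃ i, x ∈ U.obj i)
  (hU' : ∀ (n : ℕ) (i : Fin (n + 1) → U.I), IsSupercompactOrEmpty ((U.power (Fin (n + 1))).obj i))

/-- The projective resolution of the constant sheaf `ℤ` given by an open cover all of whose finite
intersections are supercompact or empty. -/
noncomputable def cechResolution :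
    ProjectiveResolution ((constantSheaf (Opens.grothendieckTopology X) AddCommGrpCat.{u}).obj
      (AddCommGrpCat.of (ULift.{u} ℤ))) where
  complex := ((presheafToSheaf (Opens.grothendieckTopology X)
    AddCommGrpCat.{u}).mapHomologicalComplex _).obj ((alternatingFaceMapComplex _).obj U.freeCech.left)
  projective n := projective_freeSheaf (U.power (Fin (n + 1))) (hU' n)
  π := ((presheafToSheaf (Opens.grothendieckTopology X)
    AddCommGrpCat.{u}).mapHomologicalComplex _).map U.freeCech.complexAug ≫
    ((HomologicalComplex.singleMapHomologicalComplex
      (presheafToSheaf (Opens.grothendieckTopology X) AddCommGrpCat.{u})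
      (ComplexShape.down ℕ) 0).app U.freeCech.right).hom
  quasiIso := by
    have h₁ := quasiIso_sheafification_complexAug U hU
    have h₂ : QuasiIso ((HomologicalComplex.singleMapHomologicalComplex
      (presheafToSheaf (Opens.grothendieckTopology X) AddCommGrpCat.{u})
      (ComplexShape.down ℕ) 0).app U.freeCech.right).hom := inferInstance
    exact quasiIso_comp (hφ := h₁) (hφ' := h₂) _ _

end Limits.FormalCoproduct

end CategoryTheory

/-! ### Computing `Ext` by a complex of morphisms from a projective resolution -/

theorem HomologicalComplex.exists_iCycles_eq {K : CochainComplex AddCommGrpCat.{u} ℕ} (n : ℕ)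
    {a : K.X n} (ha : K.d n (n + 1) a = 0) : ∃ z : K.cycles n, K.iCycles n z = a :=
  (ShortComplex.ab_exact_iff _).1 (ShortComplex.exact_of_f_is_kernel
    (ShortComplex.mk _ _ (K.iCycles_d n (n + 1))) (K.cyclesIsKernel n (n + 1) (by simp))) a ha

theorem AddCommGrpCat.sum_zsmul_apply {ι : Type*} (s : Finset ι) (z : ι → ℤ)
    {A B : AddCommGrpCat.{u}} (g : ι → (A ⟶ B)) (x : A) :
    (∑ i ∈ s, z i • g i) x = ∑ i ∈ s, z i • g i x := by
  classical
  induction s using Finset.induction_on with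
  | empty => simp
  | insert a s ha ih => simp [Finset.sum_insert ha, ← ih]

theorem CategoryTheory.Functor.map_sum_zsmul_comp {C D : Type*} [Category* C] [Category* D]
    [Preadditive C] [Preadditive D] (F : C ⥤ D) [F.Additive] {ι : Type*} (s : Finset ι)
    (z : ι → ℤ) {A B : C} (g : ι → (A ⟶ B)) {E : D} (f : F.obj B ⟶ E) :
    F.map (∑ i ∈ s, z i • g i) ≫ f = ∑ i ∈ s, z i • (F.map (g i) ≫ f) := by
  simp [Functor.map_sum, Preadditive.sum_comp]

namespace CategoryTheory.ProjectiveResolution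

open Abelian

universe w v₁ u₁

section

variable {C : Type u₁} [Category.{v₁} C] [Abelian C] [HasExt.{w} C] {Z : C}
  (R : ProjectiveResolution Z)

/-- A coboundary in degree `0` would factor through the term of the resolution in cohomological
degree `1`, which is zero. -/
theorem eq_zero_of_extMk_zero_eq_zero {Y : C} (f : R.complex.X 0 ⟶ Y)
    (hf : R.complex.d 1 0 ≫ f = 0) (h : R.extMk f 1 rfl hf = 0) : f = 0 := by
  rw [← R.extEquivCohomologyClass.apply_eq_iff_eq, extEquivCohomologyClass_extMk,
    extEquivCohomologyClass_zero, CochainComplex.HomComplex.CohomologyClass.mk_eq_zero_iff,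
    CochainComplex.HomComplex.Cocycle.toSingleMk_mem_coboundaries_iff _ _ _ _ _ 1 (by simp)] at h
  obtain ⟨g, hg⟩ := h
  rw [(CochainComplex.isZero_of_isStrictlyLE R.cochainComplex 0 1).eq_of_tgt
    (R.cochainComplex.d _ 1) 0, zero_comp] at hg
  rwa [← cancel_epi (R.cochainComplexXIso (-(0 : ℕ)) 0 rfl).hom, comp_zero, eq_comm]

/-- The functor `Ext^n(Z, -)`. -/
noncomputable def extFunctor (Z : C) (n : ℕ) : C ⥤ AddCommGrpCat.{w} where
  obj F := .of (Ext Z F n)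
  map φ := AddCommGrpCat.ofHom ((Ext.mk₀ φ).postcomp Z (add_zero n))

variable (K : C ⥤ CochainComplex AddCommGrpCat.{w} ℕ)
  (e : ∀ (n : ℕ) (F : C), (R.complex.X n ⟶ F) ≃+ (K.obj F).X n)
  (he_d : ∀ (n : ℕ) (F : C) (f : R.complex.X n ⟶ F),
    e (n + 1) F (R.complex.d (n + 1) n ≫ f) = (K.obj F).d n (n + 1) (e n F f))
  (he_map : ∀ (n : ℕ) {F G : C} (f : R.complex.X n ⟶ F) (φ : F ⟶ G),
    e n G (f ≫ φ) = (K.map φ).f n (e n F f))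

omit [HasExt.{w} C] in
include he_d in
theorem d_comp_symm_iCycles {n : ℕ} {F : C} (z : (K.obj F).cycles n) :
    R.complex.d (n + 1) n ≫ (e n F).symm ((K.obj F).iCycles n z) = 0 := by
  apply (e (n + 1) F).injective
  rw [he_d, AddEquiv.apply_symm_apply, map_zero, ← ConcreteCategory.comp_apply,
    HomologicalComplex.iCycles_d]
  rfl

/-- The class in `Ext^n(Z, F)` of a cocycle of a complex computing `Ext`. -/
noncomputable def extOfCycles (n : ℕ) (F : C) :
    (K.obj F).cycles n ⟶ (extFunctor Z n).obj F :=
  AddCommGrpCat.ofHom (AddMonoidHom.mk' (fun z => R.extMk _ (n + 1) rfl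
    (R.d_comp_symm_iCycles K e he_d z)) (fun x y => by
      refine Eq.trans ?_ (add_extMk ..).symm
      congr 1
      exact (congrArg _ (map_add ((K.obj F).iCycles n).hom x y)).trans (map_add _ _ _)))

theorem extOfCycles_apply {n : ℕ} {F : C} (z : (K.obj F).cycles n) :
    R.extOfCycles K e he_d n F z = R.extMk ((e n F).symm ((K.obj F).iCycles n z)) (n + 1) rfl
      (R.d_comp_symm_iCycles K e he_d z) := rfl

theorem extOfCycles_surjective (n : ℕ) (F : C) :
    Function.Surjective (R.extOfCycles K e he_d n F) := by
  intro α
  obtain ⟨f, hf, rfl⟩ := R.extMk_surjective α (n + 1) rfl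
  have h : (K.obj F).d n (n + 1) (e n F f) = 0 := by rw [← he_d, hf, map_zero]
  obtain ⟨z, h'⟩ := HomologicalComplex.exists_iCycles_eq n h
  refine ⟨z, ?_⟩
  rw [extOfCycles_apply]
  congr 1
  rw [h', AddEquiv.symm_apply_apply]

theorem extOfCycles_toCycles (n m : ℕ) (F : C) :
    (K.obj F).toCycles m n ≫ R.extOfCycles K e he_d n F = 0 := by
  ext y
  rw [ConcreteCategory.comp_apply, extOfCycles_apply]
  have h : (K.obj F).iCycles n ((K.obj F).toCycles m n y) = (K.obj F).d m n y := by
    rw [← ConcreteCategory.comp_apply, HomologicalComplex.toCycles_i]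
  by_cases hm : m + 1 = n
  · subst hm
    refine (R.extMk_eq_zero_iff _ _ _ _ m rfl).2 ⟨(e m F).symm y, (e (m + 1) F).injective ?_⟩
    rw [he_d, AddEquiv.apply_symm_apply, AddEquiv.apply_symm_apply, h]
  -- This covers `n = 0`, whose predecessor in the complex shape is `0` itself by convention.
  · have h0 : (K.obj F).iCycles n ((K.obj F).toCycles m n y) = 0 := by
      rw [h, (K.obj F).shape m n hm]
      rfl
    refine Eq.trans ?_ (R.extMk_zero (n + 1) rfl)
    congr 1
    rw [h0, map_zero]

/-- This gives injectivity on cohomology. In degree `0` the cocycle itself vanishes; in degree `m +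
1` it factors through the differential of the resolution, hence is a coboundary. -/
theorem homologyπ_eq_zero_of_extOfCycles_eq_zero (n : ℕ) (F : C) (z : (K.obj F).cycles n)
    (hz : R.extOfCycles K e he_d n F z = 0) : (K.obj F).homologyπ n z = 0 := by
  have hi : Function.Injective ((K.obj F).iCycles n) :=
    (AddCommGrpCat.mono_iff_injective _).1 inferInstance
  rw [extOfCycles_apply] at hz
  cases n with
  | zero =>
    have := R.eq_zero_of_extMk_zero_eq_zero _ _ hz
    rw [AddEquiv.map_eq_zero_iff] at this
    rw [hi (this.trans (map_zero _).symm), map_zero]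
  | succ m =>
    obtain ⟨g, hg⟩ := (R.extMk_eq_zero_iff _ _ _ _ m rfl).1 hz
    have : z = (K.obj F).toCycles m (m + 1) (e m F g) := by
      apply hi
      rw [← ConcreteCategory.comp_apply, HomologicalComplex.toCycles_i, ← he_d, hg,
        AddEquiv.apply_symm_apply]
    rw [this, ← ConcreteCategory.comp_apply, HomologicalComplex.toCycles_comp_homologyπ]
    rfl

/-- The comparison of the cohomology of a complex computing `Ext` with `Ext`. -/
noncomputable def extOfHomology (n : ℕ) (F : C) :
    (K.obj F).homology n ⟶ (extFunctor Z n).obj F :=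
  ((K.obj F).homologyIsCokernel _ n rfl).desc
    (CokernelCofork.ofπ _ (R.extOfCycles_toCycles K e he_d n _ F))

theorem homologyπ_extOfHomology (n : ℕ) (F : C) :
    (K.obj F).homologyπ n ≫ R.extOfHomology K e he_d n F = R.extOfCycles K e he_d n F :=
  ((K.obj F).homologyIsCokernel _ n rfl).fac _ WalkingParallelPair.one

theorem extOfHomology_bijective (n : ℕ) (F : C) :
    Function.Bijective (R.extOfHomology K e he_d n F) := by
  have hπ : Function.Surjective ((K.obj F).homologyπ n) :=
    (AddCommGrpCat.epi_iff_surjective _).1 inferInstance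
  have hc (z : (K.obj F).cycles n) : R.extOfHomology K e he_d n F ((K.obj F).homologyπ n z) =
      R.extOfCycles K e he_d n F z := by
    rw [← ConcreteCategory.comp_apply, homologyπ_extOfHomology]
  refine ⟨(injective_iff_map_eq_zero (R.extOfHomology K e he_d n F).hom).2 fun x hx => ?_,
    fun y => ?_⟩
  · obtain ⟨z, rfl⟩ := hπ x
    exact R.homologyπ_eq_zero_of_extOfCycles_eq_zero K e he_d n F z ((hc z).symm.trans hx)
  · obtain ⟨z, rfl⟩ := R.extOfCycles_surjective K e he_d n F y
    exact ⟨_, hc z⟩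

include he_d he_map in
theorem extOfCycles_naturality (n : ℕ) {F G : C} (φ : F ⟶ G) :
    HomologicalComplex.cyclesMap (K.map φ) n ≫ R.extOfCycles K e he_d n G =
      R.extOfCycles K e he_d n F ≫ (extFunctor Z n).map φ := by
  ext z
  refine Eq.trans ?_ (R.extMk_comp_mk₀ _ (n + 1) rfl (R.d_comp_symm_iCycles K e he_d z) φ).symm
  rw [ConcreteCategory.comp_apply, extOfCycles_apply]
  congr 1
  apply (e n G).injective
  rw [he_map, AddEquiv.apply_symm_apply, AddEquiv.apply_symm_apply, ← ConcreteCategory.comp_apply,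
    ← ConcreteCategory.comp_apply, HomologicalComplex.cyclesMap_i]

include he_d he_map in
/-- If a functorial complex computes the morphisms from a projective resolution of `Z`, then its
cohomology is `Ext^n(Z, -)`, as a functor. -/
theorem nonempty_homology_iso_extFunctor (n : ℕ) :
    Nonempty (K ⋙ HomologicalComplex.homologyFunctor _ _ n ≅ extFunctor Z n) :=
  ⟨NatIso.ofComponents (fun F =>
    have : IsIso (R.extOfHomology K e he_d n F) :=
      (ConcreteCategory.isIso_iff_bijective _).2 (R.extOfHomology_bijective K e he_d n F)
    @asIso _ _ _ _ (R.extOfHomology K e he_d n F) this) (fun {F G} φ => by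
      change HomologicalComplex.homologyMap (K.map φ) n ≫ R.extOfHomology K e he_d n G =
        R.extOfHomology K e he_d n F ≫ (extFunctor Z n).map φ
      rw [← cancel_epi ((K.obj F).homologyπ n), HomologicalComplex.homologyπ_naturality_assoc,
        homologyπ_extOfHomology, R.extOfCycles_naturality K e he_d he_map,
        ← homologyπ_extOfHomology, Category.assoc])⟩

end

end CategoryTheory.ProjectiveResolution

/-! ### Čech cohomology as sheaf cohomology -/

namespace CategoryTheory.Limits.FormalCoproduct

open AlgebraicTopology

variable {X : TopCat.{u}} (U : FormalCoproduct.{u} (Opens X))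

/-- Both differentials are alternating sums over the faces of the Čech object, and the summands
match by naturality of `freeSheafHom` in the formal coproduct. -/
theorem freeSheafHom_d_comp (n : ℕ) (F : Sheaf (Opens.grothendieckTopology X) AddCommGrpCat.{u})
    (f : (freeSheaf.{u} X).obj (U.power (Fin (n + 1))) ⟶ F) :
    freeSheafHom (U.power (Fin (n + 2))) F
        ((presheafToSheaf (Opens.grothendieckTopology X) AddCommGrpCat.{u}).map
          (((alternatingFaceMapComplex _).obj U.freeCech.left).d (n + 1) n) ≫ f) =
      ((cochainComplexFunctor U.cech).obj F.obj).d n (n + 1)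
        (freeSheafHom (U.power (Fin (n + 1))) F f) := by
  have h₁ : ((alternatingFaceMapComplex _).obj U.freeCech.left).d (n + 1) n =
      ∑ i : Fin (n + 2), (-1 : ℤ) ^ (i : ℕ) • (freePresheaf (Opens X)).map (U.cech.δ i) :=
    alternatingFaceMapComplex_obj_d _ _
  have h₂ : ((cochainComplexFunctor U.cech).obj F.obj).d n (n + 1) =
      ∑ i : Fin (n + 2), (-1 : ℤ) ^ (i : ℕ) •
        ((evalOp (Opens X) AddCommGrpCat.{u}).obj F.obj).map (U.cech.δ i).op :=
    CochainComplex.of_d (fun n => ((cosimplicialObjectFunctor U.cech).obj F.obj).obj (.mk n)) _ _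
  have h₃ : (presheafToSheaf (Opens.grothendieckTopology X) AddCommGrpCat.{u}).map
      (((alternatingFaceMapComplex _).obj U.freeCech.left).d (n + 1) n) ≫ f =
      ∑ i : Fin (n + 2), (-1 : ℤ) ^ (i : ℕ) • ((freeSheaf.{u} X).map (U.cech.δ i) ≫ f) := by
    rw [h₁]
    exact Functor.map_sum_zsmul_comp _ _ _ _ _
  rw [h₂]
  refine (congrArg (freeSheafHom (U.power (Fin (n + 2))) F) h₃).trans ?_
  refine (map_sum (freeSheafHom (U.power (Fin (n + 2))) F) _ _).trans ?_
  refine Eq.trans (Finset.sum_congr rfl fun i _ => ?_)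
    (AddCommGrpCat.sum_zsmul_apply Finset.univ (fun i : Fin (n + 2) => (-1 : ℤ) ^ (i : ℕ))
      _ _).symm
  exact (map_zsmul _ _ _).trans (congrArg _ (freeSheafHom_map_comp _ _))

theorem nonempty_cech_iso_sheafCohomology {ι : Type u} (U : ι → Opens X)
    (hU : ∀ x : X, ∃ i, x ∈ U i)
    (hU' : ∀ (n : ℕ) (i : Fin (n + 1) → ι), IsSupercompactOrEmpty (∏ᶜ fun k => U (i k)))
    (n : ℕ) : Nonempty (coverCohomology U n ≅ sheafCohomology X n) :=
  (cechResolution (FormalCoproduct.mk _ U) hU hU').nonempty_homology_iso_extFunctor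
    (sheafToPresheaf (Opens.grothendieckTopology X) AddCommGrpCat.{u} ⋙ cechComplexFunctor U)
    (fun n F => freeSheafHom ((FormalCoproduct.mk _ U).power (Fin (n + 1))) F)
    (fun n F f => freeSheafHom_d_comp (FormalCoproduct.mk _ U) n F f)
    (fun _ _ _ f φ => freeSheafHom_comp f φ) n

end CategoryTheory.Limits.FormalCoproduct

/-! ### Morphisms into the spectrum of a monoid -/

theorem IsLocalMonoidMorphism.comp {X Y Z : AlgebraicGeometry.SheafedSpace CommMonCat.{u}}
    {f : X ⟶ Y} {g : Y ⟶ Z} (hf : IsLocalMonoidMorphism f) (hg : IsLocalMonoidMorphism g) :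
    IsLocalMonoidMorphism (f ≫ g) :=
  fun x V hx s h => hg _ V hx s (hf x _ hx (g.hom.c.app (op V) s) h)

namespace MonoidPrime

variable {L M : Type u} [CommMonoid L] [CommMonoid M]

/-- The preimage of a prime ideal under a homomorphism. -/
def comap (φ : M →* L) (q : MonoidPrime L) : MonoidPrime M where
  carrier := φ ⁻¹' q.carrier
  mul_mem' a x hx := by
    rw [Set.mem_preimage, map_mul]
    exact q.mul_mem' _ hx
  one_notMem' := by
    rw [Set.mem_preimage, map_one]
    exact q.one_notMem'
  mem_or_mem' h := q.mem_or_mem' (by rwa [Set.mem_preimage, map_mul] at h)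

theorem continuous_comap (φ : M →* L) : Continuous (comap φ) :=
  continuous_generateFrom_iff.2 (by
    rintro _ ⟨f, rfl⟩
    exact isOpen_basicOpen (φ f))

end MonoidPrime

theorem Localization.mk_mul_one {M : Type*} [CommMonoid M] {S : Submonoid M} (a b : M) :
    (Localization.mk (a * b) 1 : Localization S) = Localization.mk a 1 * Localization.mk b 1 := by
  rw [Localization.mk_mul, mul_one]

theorem Localization.mk_mul_mk_one {M : Type*} [CommMonoid M] {S : Submonoid M} (a : M) (b : S) :
    (Localization.mk a b * Localization.mk (b : M) 1 : Localization S) = Localization.mk a 1 := by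
  rw [Localization.mk_mul, Localization.mk_eq_mk_iff, Localization.r_iff_exists]
  exact ⟨1, by simp [mul_comm]⟩

/-- The non-units of the stalk at `p` are the fractions with numerator in `p`, so `p` can be read
off from invertibility of germs. -/
theorem MonoidPrime.isUnit_mk_iff {M : Type u} [CommMonoid M] (p : MonoidPrime M) (a : M)
    (b : p.compl) : IsUnit (Localization.mk a b) ↔ a ∈ p.compl := by
  refine ⟨fun h => ?_, fun ha => ?_⟩
  · obtain ⟨x, hx⟩ := h.exists_right_inv
    induction x with | H x =>
    rw [Localization.mk_mul, ← Localization.mk_one, Localization.mk_eq_mk_iff,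
      Localization.r_iff_exists] at hx
    obtain ⟨c, hc⟩ := hx
    intro ha
    have : (c : M) * (((1 : p.compl) : M) * (a * x.1)) ∈ p.carrier := by
      rw [show (c : M) * (((1 : p.compl) : M) * (a * x.1)) = (c * x.1) * a by
        rw [OneMemClass.coe_one, one_mul, mul_assoc, mul_comm a]]
      exact p.mul_mem' _ ha
    rw [hc] at this
    exact (c * ((b * x.2) * 1)).2 this
  · refine IsUnit.of_mul_eq_one (Localization.mk b ⟨a, ha⟩) ?_
    rw [Localization.mk_mul, mul_comm (a : M)]
    exact Localization.mk_self (b * ⟨a, ha⟩)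

namespace MonoidSpec

variable {L M : Type u} [CommMonoid L] [CommMonoid M]

/-- The section `m / 1` of the structure sheaf. -/
def const (V : Opens (top M)) : M →* sections M V where
  toFun m := ⟨fun _ => Localization.mk m 1, fun p => ⟨V, p.2, 𝟙 _, m, 1, fun _ =>
    ⟨Submonoid.one_mem _, rfl⟩⟩⟩
  map_one' := Subtype.ext (funext fun _ => Localization.mk_one)
  map_mul' _ _ := Subtype.ext (funext fun _ => Localization.mk_mul_one _ _)

/-- The homomorphism of localisations at prime ideals induced by a homomorphism. -/
noncomputable def localMap (φ : M →* L) (q : top L) :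
    LocalizationAt M (MonoidPrime.comap φ q) →* LocalizationAt L q :=
  (Localization.monoidOf _).map (T := MonoidPrime.compl (M := L) q) (g := φ) (fun y => y.2)
    (Localization.monoidOf _)

theorem localMap_mk (φ : M →* L) (q : top L) (a b : M)
    (hb : b ∈ MonoidPrime.compl (M := M) (MonoidPrime.comap φ q)) :
    localMap φ q (Localization.mk a ⟨b, hb⟩) = Localization.mk (φ a) ⟨φ b, hb⟩ := by
  rw [Localization.mk_eq_monoidOf_mk', Localization.mk_eq_monoidOf_mk']
  exact Submonoid.LocalizationMap.map_mk' ..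

/-- The pullback of sections along the map of spectra induced by a homomorphism. -/
noncomputable def pullback (φ : M →* L) (V : Opens (top M)) :
    sections M V →* sections L ((Opens.map (TopCat.ofHom ⟨_, MonoidPrime.continuous_comap φ⟩ :
      top L ⟶ top M)).obj V) where
  toFun s := ⟨fun q => localMap φ q.1 (s.1 ⟨_, q.2⟩), fun q => by
    obtain ⟨W, hW, i, a, b, h⟩ := s.2 ⟨_, q.2⟩
    refine ⟨(Opens.map _).obj W, hW, (Opens.map _).map i, φ a, φ b, fun r => ?_⟩
    obtain ⟨hb, e⟩ := h ⟨_, r.2⟩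
    exact ⟨hb, (congrArg (localMap φ r.1) e).trans (localMap_mk φ r.1 a b hb)⟩⟩
  map_one' := Subtype.ext (funext fun q => map_one (localMap φ q.1))
  map_mul' s t := Subtype.ext (funext fun q => map_mul (localMap φ q.1) _ _)

theorem isUnit_of_localMap (φ : M →* L) (q : top L)
    (x : LocalizationAt M (MonoidPrime.comap φ q)) (h : IsUnit (localMap φ q x)) : IsUnit x := by
  induction x using Localization.induction_on with | H x =>
  rw [localMap_mk] at h
  exact (MonoidPrime.isUnit_mk_iff _ _ _).2 ((MonoidPrime.isUnit_mk_iff (M := L) q _ _).1 h)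

/-- The pointwise inverses again form a section: where `s` is `a / b`, the inverse is `b / a`. -/
theorem isUnit_of_forall {V : Opens (top M)} (s : sections M V) (h : ∀ p, IsUnit (s.1 p)) :
    IsUnit s := by
  choose t ht using fun p => (h p).exists_right_inv
  refine IsUnit.of_mul_eq_one ⟨t, fun p => ?_⟩ (Subtype.ext (funext ht))
  obtain ⟨W, hW, i, a, b, k⟩ := s.2 p
  refine ⟨W, hW, i, b, a, fun q => ?_⟩
  obtain ⟨hb, e⟩ := k q
  have ha : a ∈ MonoidPrime.compl (M := M) q.1 := by
    rw [← MonoidPrime.isUnit_mk_iff _ a ⟨b, hb⟩, ← e]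
    exact h _
  refine ⟨ha, ?_⟩
  rw [← (h (i q)).mul_right_inj]
  refine (ht (i q)).trans (Eq.trans ?_ (congrArg (· * _) e.symm))
  rw [Localization.mk_mul, mul_comm a]
  exact (Localization.mk_self (⟨b, hb⟩ * ⟨a, ha⟩ : MonoidPrime.compl (M := M) q.1)).symm

theorem isUnit_apply {V : Opens (top M)} {s : sections M V} (h : IsUnit s) (p : V) :
    IsUnit (s.1 p) :=
  h.map ((Pi.evalMonoidHom _ p).comp (sections M V).subtype)

theorem isUnit_const_iff {V : Opens (top M)} {m : M} :
    IsUnit (const V m) ↔ ∀ p : V, m ∈ MonoidPrime.compl (M := M) p.1 :=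
  ⟨fun h p => (MonoidPrime.isUnit_mk_iff _ _ _).1 (isUnit_apply h p),
    fun h => isUnit_of_forall _ fun p => (MonoidPrime.isUnit_mk_iff _ _ _).2 (h p)⟩

/-- The set `D(f)` as an open set. -/
def basicOpens (f : M) : Opens (top M) := ⟨_, MonoidPrime.isOpen_basicOpen f⟩

end MonoidSpec

open MonoidSpec

variable {L M : Type u} [CommMonoid L] [CommMonoid M]

/-- The morphism of spectra induced by a homomorphism of monoids. -/
noncomputable def monoidSpecMap (φ : M →* L) : monoidSpec L ⟶ monoidSpec M :=
  ⟨{  base := TopCat.ofHom ⟨_, MonoidPrime.continuous_comap φ⟩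
      c := { app V := CommMonCat.ofHom (pullback φ V.unop)
             naturality _ _ _ := rfl } }⟩

theorem monoidSpecMap_const (φ : M →* L) (V : Opens (top M)) (m : M) :
    pullback φ V (const V m) = const _ (φ m) := by
  refine Subtype.ext (funext fun q => (localMap_mk φ q.1 m 1 _).trans ?_)
  exact congrArg (Localization.mk (φ m)) (Subtype.ext (map_one φ))

theorem isLocalMonoidMorphism_monoidSpecMap (φ : M →* L) :
    IsLocalMonoidMorphism (monoidSpecMap φ) := by
  rintro (q : MonoidPrime L) V hq s ⟨U, i, hU, h⟩
  obtain ⟨W, hW, j, a, b, k⟩ := s.2 ⟨_, hq⟩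
  have hs : IsUnit (s.1 ⟨MonoidPrime.comap φ q, hq⟩) := isUnit_of_localMap φ q _
    (isUnit_apply (s := (monoidSpec L).presheaf.map i.op (pullback φ V s)) h ⟨q, hU⟩)
  obtain ⟨hb, e⟩ := k ⟨_, hW⟩
  have ha : MonoidPrime.comap φ q ∈ basicOpens a := by
    refine (MonoidPrime.isUnit_mk_iff _ a ⟨b, hb⟩).1 ?_
    rw [← e]
    exact hs
  -- On `W` the section is `a / b`; it becomes invertible after restriction to the locus where `a`
  -- avoids the prime ideal.
  refine ⟨W ⊓ basicOpens a, Opens.infLELeft _ _ ≫ j, ⟨hW, ha⟩, ?_⟩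
  refine isUnit_of_forall _ fun r => ?_
  obtain ⟨hb, e⟩ := k ⟨r.1, r.2.1⟩
  refine (congrArg IsUnit e).mpr ?_
  exact (MonoidPrime.isUnit_mk_iff _ a ⟨b, hb⟩).2 r.2.2

theorem MonoidSpec.exists_map_mul_const_eq {V : Opens (top M)} (s : sections M V) {p : top M}
    (hp : p ∈ V) : ∃ (W : Opens (top M)) (j : W ⟶ V) (a b : M), p ∈ W ∧ IsUnit (const W b) ∧
      (show sections M W from (structurePresheaf M).map j.op s) * const W b = const W a := by
  obtain ⟨W, hW, j, a, b, k⟩ := s.2 ⟨p, hp⟩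
  refine ⟨W, j, a, b, hW, isUnit_const_iff.2 fun q => (k q).1, ?_⟩
  refine Subtype.ext (funext fun q => ?_)
  obtain ⟨hb, e⟩ := k q
  refine (congrArg (· * Localization.mk b 1) e).trans ?_
  exact Localization.mk_mul_mk_one a ⟨b, hb⟩

variable {Y : AlgebraicGeometry.SheafedSpace CommMonCat.{u}}

/-- Thanks to locality, the image of a point is determined by which global sections become
invertible near `y`. -/
theorem mem_compl_base_iff {f : Y ⟶ monoidSpec M} (hf : IsLocalMonoidMorphism f) (y : Y) (m : M) :
    m ∈ MonoidPrime.compl (M := M) (f.hom.base y) ↔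
      ∃ (U : Opens Y) (_ : y ∈ U), IsUnit (Y.presheaf.map (homOfLE le_top : U ⟶ ⊤).op
        (f.hom.c.app (op ⊤) (const ⊤ m))) := by
  constructor
  · intro h
    refine ⟨(Opens.map f.hom.base).obj (basicOpens m), h, ?_⟩
    have h₁ : IsUnit ((monoidSpec M).presheaf.map (homOfLE le_top : basicOpens m ⟶ ⊤).op
      (const ⊤ m)) := isUnit_const_iff.2 fun p => p.2
    have h₂ := (ConcreteCategory.congr_hom (f.hom.c.naturality
      (homOfLE le_top : basicOpens m ⟶ ⊤).op) (const ⊤ m))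
    exact h₂ ▸ (h₁.map (f.hom.c.app (op (basicOpens m))).hom)
  · rintro ⟨U, hU, h⟩
    obtain ⟨W, j, hW, k⟩ := hf y ⊤ trivial (const ⊤ m) ⟨U, homOfLE le_top, hU, h⟩
    exact isUnit_const_iff.1 k ⟨_, hW⟩

/-- The maps of points agree by `mem_compl_base_iff`. A section `s` locally satisfies `s * b = a`
with `b` invertible and `a`, `b` from `M`, so its image is determined by the images of elements of
`M`. -/
theorem monoidSpec_hom_ext {f g : Y ⟶ monoidSpec M} (hf : IsLocalMonoidMorphism f)
    (hg : IsLocalMonoidMorphism g)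
    (h : ∀ m : M, f.hom.c.app (op ⊤) (const ⊤ m) = g.hom.c.app (op ⊤) (const ⊤ m)) : f = g := by
  have hbase : f.hom.base = g.hom.base := by
    ext y
    refine MonoidPrime.ext (Set.ext fun m => not_iff_not.1 ?_)
    refine (mem_compl_base_iff hf y m).trans (Iff.trans ?_ (mem_compl_base_iff hg y m).symm)
    rw [h]
  obtain ⟨⟨b, c⟩⟩ := f
  obtain ⟨⟨b', c'⟩⟩ := g
  obtain rfl : b = b' := hbase
  suffices c = c' by rw [this]
  ext V s
  choose W j a b' hW hb hs using fun y : (Opens.map b).obj V =>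
    exists_map_mul_const_eq (V := V) s y.2
  refine TopCat.Sheaf.eq_of_locally_eq' ⟨Y.presheaf, Y.IsSheaf⟩
    (fun y => (Opens.map b).obj (W y)) ((Opens.map b).obj V)
    (fun y => (Opens.map b).map (j y)) ?_ _ _ fun y => ?_
  · intro y hy
    exact Opens.mem_iSup.2 ⟨⟨y, hy⟩, hW _⟩
  have hc (m : M) : c.app (op (W y)) (const (W y) m) = c'.app (op (W y)) (const (W y) m) := by
    have h₁ := ConcreteCategory.congr_hom (c.naturality (homOfLE le_top : W y ⟶ ⊤).op) (const ⊤ m)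
    have h₂ := ConcreteCategory.congr_hom (c'.naturality (homOfLE le_top : W y ⟶ ⊤).op) (const ⊤ m)
    exact h₁.trans ((congrArg _ (h m)).trans h₂.symm)
  have h₁ := ConcreteCategory.congr_hom (c.naturality (j y).op) s
  have h₂ := ConcreteCategory.congr_hom (c'.naturality (j y).op) s
  refine h₁.symm.trans (Eq.trans ?_ h₂)
  have h₃ : IsUnit (c.app (op (W y)) (const (W y) (b' y))) := (hb y).map (c.app (op (W y))).hom
  refine h₃.mul_left_inj.1 ?_
  have h₄ := (map_mul (c.app (op (W y))).hom _ _).symm.trans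
    (congrArg (c.app (op (W y))).hom (hs y))
  have h₅ := (map_mul (c'.app (op (W y))).hom _ _).symm.trans
    (congrArg (c'.app (op (W y))).hom (hs y))
  refine h₄.trans ((hc (a y)).trans (h₅.symm.trans ?_))
  exact congrArg (_ * ·) (hc (b' y)).symm

/-- A global section is a single fraction near the closed point, hence everywhere, and its
denominator lies outside the ideal of non-units. -/
theorem MonoidSpec.const_top_surjective : Function.Surjective (const (M := M) ⊤) := by
  intro s
  obtain ⟨W, hW, i, a, b, k⟩ := s.2 ⟨MonoidPrime.maximal M, trivial⟩
  have hW' : ∀ p : MonoidPrime M, p ∈ W := fun p =>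
    (MonoidPrime.eq_univ_of_maximal_mem W.isOpen hW).ge trivial
  obtain ⟨hb, -⟩ := k ⟨_, hW⟩
  obtain ⟨c, hc⟩ := (not_not.1 hb : IsUnit b).exists_right_inv
  refine ⟨a * c, Subtype.ext (funext fun p => ?_)⟩
  obtain ⟨hb', e⟩ := k ⟨p.1, hW' p.1⟩
  refine Eq.trans ?_ e.symm
  refine Localization.mk_eq_mk_iff.2 (Localization.r_iff_exists.2 ⟨1, ?_⟩)
  change 1 * (b * (a * c)) = 1 * (1 * a)
  rw [mul_left_comm b, hc, mul_one, one_mul, one_mul]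

theorem MonoidSpec.const_top_injective : Function.Injective (const (M := M) ⊤) := by
  intro a b h
  have : Localization.mk a 1 = Localization.mk b (1 : (MonoidPrime.maximal M).compl) :=
    congrFun (congrArg Subtype.val h) ⟨MonoidPrime.maximal M, trivial⟩
  obtain ⟨c, hc⟩ := Localization.r_iff_exists.1 (Localization.mk_eq_mk_iff.1 this)
  have hu : IsUnit (c : M) := not_not.1 c.2
  simpa [hu.mul_right_inj] using hc

/-- The homomorphism is the effect of `f` on global sections, which for a spectrum are the monoid
itself. -/
theorem exists_eq_monoidSpecMap (f : monoidSpec L ⟶ monoidSpec M) (hf : IsLocalMonoidMorphism f) :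
    ∃ φ : M →* L, f = monoidSpecMap φ := by
  let e : L ≃* sections L ⊤ :=
    MulEquiv.ofBijective (const ⊤) ⟨const_top_injective, const_top_surjective⟩
  let φ : M →* L := e.symm.toMonoidHom.comp
    (MonoidHom.comp (P := sections L ⊤) (f.hom.c.app (op ⊤)).hom (const ⊤))
  refine ⟨φ, monoidSpec_hom_ext hf (isLocalMonoidMorphism_monoidSpecMap φ) fun m => ?_⟩
  refine Eq.trans ?_ (monoidSpecMap_const φ ⊤ m).symm
  exact (e.apply_symm_apply (f.hom.c.app (op ⊤) (const ⊤ m))).symm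

theorem monoidSpecMap_comp {K : Type u} [CommMonoid K] (φ : M →* L) (ψ : L →* K) :
    monoidSpecMap ψ ≫ monoidSpecMap φ = monoidSpecMap (ψ.comp φ) := by
  refine monoidSpec_hom_ext ?_ (isLocalMonoidMorphism_monoidSpecMap _) fun m => ?_
  · exact (isLocalMonoidMorphism_monoidSpecMap ψ).comp (isLocalMonoidMorphism_monoidSpecMap φ)
  · refine Eq.trans ?_ (monoidSpecMap_const (ψ.comp φ) ⊤ m).symm
    refine (congrArg ((monoidSpecMap ψ).hom.c.app _) (monoidSpecMap_const φ ⊤ m)).trans ?_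
    exact monoidSpecMap_const ψ ⊤ (φ m)

open MonoidSpec

/-! ### `D(f)` as the spectrum of the localisation `M_f` -/

section Localization

variable {M : Type u} [CommMonoid M] (f : M)

/-- The canonical homomorphism from `M` to the localisation `M_f`. -/
def toAway : M →* Localization (Submonoid.powers f) where
  toFun m := Localization.mk m 1
  map_one' := Localization.mk_one
  map_mul' := Localization.mk_mul_one

theorem mk_mul_toAway (a : M) (s : Submonoid.powers f) :
    Localization.mk a s * toAway f s = toAway f a :=
  Localization.mk_mul_mk_one a s

theorem isUnit_toAway (s : Submonoid.powers f) : IsUnit (toAway f s) :=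
  IsUnit.of_mul_eq_one (Localization.mk 1 s) (by
    refine (mul_comm _ _).trans ((mk_mul_toAway f 1 s).trans ?_)
    exact Localization.mk_one)

variable {f}

theorem MonoidPrime.mul_mem_iff_of_isUnit (q : MonoidPrime M) {x : M} (hx : IsUnit x) (a : M) :
    a * x ∈ q.carrier ↔ a ∈ q.carrier := by
  refine ⟨fun h => (q.mem_or_mem' h).resolve_right fun h' => ?_, fun h => ?_⟩
  · obtain ⟨y, hy⟩ := hx.exists_left_inv
    exact q.one_notMem' (hy ▸ q.mul_mem' y h')
  · rw [mul_comm]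
    exact q.mul_mem' x h

theorem MonoidPrime.mk_mem_iff (q : MonoidPrime (Localization (Submonoid.powers f))) (a : M)
    (s : Submonoid.powers f) : Localization.mk a s ∈ q.carrier ↔ toAway f a ∈ q.carrier := by
  rw [← mk_mul_toAway, q.mul_mem_iff_of_isUnit (isUnit_toAway f s)]

theorem injective_comap_toAway : Function.Injective (MonoidPrime.comap (toAway f)) := by
  intro q r h
  refine MonoidPrime.ext (Set.ext fun x => ?_)
  induction x using Localization.induction_on with | H x =>
  rw [q.mk_mem_iff, r.mk_mem_iff]
  exact Set.ext_iff.1 (congrArg MonoidPrime.carrier h) x.1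

theorem MonoidPrime.powers_le_compl {p : MonoidPrime M} (hp : f ∉ p.carrier) :
    Submonoid.powers f ≤ p.compl :=
  Submonoid.powers_le.2 hp

theorem exists_comap_toAway_eq {p : MonoidPrime M} (hp : f ∉ p.carrier) :
    ∃ q, MonoidPrime.comap (toAway f) q = p := by
  let S : Set (Localization (Submonoid.powers f)) :=
    {x | ∃ a s, x = Localization.mk a s ∧ a ∈ p.carrier}
  -- Membership does not depend on the chosen fraction, because powers of `f` avoid the prime ideal
  -- `p`.
  have hS (a : M) (s : Submonoid.powers f) : Localization.mk a s ∈ S ↔ a ∈ p.carrier := by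
    refine ⟨?_, fun h => ⟨a, s, rfl, h⟩⟩
    rintro ⟨b, t, h, hb⟩
    obtain ⟨c, hc⟩ := Localization.r_iff_exists.1 (Localization.mk_eq_mk_iff.1 h)
    have h₁ : (c : M) * (t * a) ∈ p.carrier := by
      rw [hc]
      exact p.mul_mem' _ (p.mul_mem' _ hb)
    have h₂ := p.mem_or_mem' ((mul_assoc (c : M) t a) ▸ h₁)
    exact h₂.resolve_left (MonoidPrime.powers_le_compl hp (c * t).2)
  refine ⟨⟨S, ?_, ?_, ?_⟩, MonoidPrime.ext (Set.ext fun m => hS m 1)⟩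
  · intro x y hy
    induction x using Localization.induction_on with | H x =>
    induction y using Localization.induction_on with | H y =>
    rw [Localization.mk_mul, hS]
    exact p.mul_mem' _ ((hS _ _).1 hy)
  · rw [← Localization.mk_one, hS]
    exact p.one_notMem'
  · intro x y h
    induction x using Localization.induction_on with | H x =>
    induction y using Localization.induction_on with | H y =>
    rw [Localization.mk_mul, hS] at h
    rw [hS, hS]
    exact p.mem_or_mem' h

theorem range_comap_toAway :
    Set.range (MonoidPrime.comap (toAway f)) = MonoidPrime.basicOpen f := by
  ext p
  refine ⟨?_, fun hp => exists_comap_toAway_eq hp⟩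
  rintro ⟨q, rfl⟩ h
  exact q.one_notMem' ((q.mul_mem_iff_of_isUnit
    (isUnit_toAway f ⟨f, Submonoid.mem_powers f⟩) 1).1 (by rwa [one_mul]))

theorem isOpenEmbedding_comap_toAway :
    Topology.IsOpenEmbedding (MonoidPrime.comap (toAway f)) where
  injective := injective_comap_toAway
  isOpen_range := (range_comap_toAway (f := f)).symm ▸ MonoidPrime.isOpen_basicOpen f
  eq_induced := by
    refine Eq.trans ?_ (induced_generateFrom_eq).symm
    refine congrArg generateFrom (Set.ext fun V => ⟨?_, ?_⟩)
    · rintro ⟨(x : Localization (Submonoid.powers f)), rfl⟩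
      induction x using Localization.induction_on with | H x =>
      refine ⟨MonoidPrime.basicOpen x.1, ⟨x.1, rfl⟩, Set.ext fun q => ?_⟩
      exact not_congr (MonoidPrime.mk_mem_iff (f := f) q x.1 x.2).symm
    · rintro ⟨_, ⟨a, rfl⟩, rfl⟩
      exact ⟨toAway f a, rfl⟩

theorem localMap_toAway_injective (q : top (Localization (Submonoid.powers f))) :
    Function.Injective (localMap (toAway f) q) := by
  intro x y h
  induction x using Localization.induction_on with | H x =>
  induction y using Localization.induction_on with | H y =>
  obtain ⟨a, b, hb⟩ := x
  obtain ⟨c, d, hd⟩ := y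
  rw [localMap_mk, localMap_mk] at h
  obtain ⟨⟨z, hz⟩, hc⟩ := Localization.r_iff_exists.1 (Localization.mk_eq_mk_iff.1 h)
  induction z using Localization.induction_on with | H z =>
  obtain ⟨z, s⟩ := z
  -- The witness of equality is itself a fraction `z / s`; multiplying by `s` gives an equality
  -- between images of elements of `M`.
  have h₁ : toAway f (z * (d * a)) = toAway f (z * (b * c)) := by
    have := congrArg (· * toAway f s) hc
    simp only [mul_right_comm (Localization.mk z s), mk_mul_toAway] at this
    simpa only [map_mul] using this
  obtain ⟨t, ht⟩ := Localization.r_iff_exists.1 (Localization.mk_eq_mk_iff.1 h₁)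
  have hz' : z ∈ (MonoidPrime.comap (toAway f) q).compl := fun h' => hz ((q.mk_mem_iff z s).2 h')
  have ht' : (t : M) ∈ (MonoidPrime.comap (toAway f) q).compl := fun h' =>
    q.one_notMem' ((q.mul_mem_iff_of_isUnit (isUnit_toAway f t) 1).1 (by rwa [one_mul]))
  refine Localization.mk_eq_mk_iff.2 (Localization.r_iff_exists.2 ⟨⟨t * z, mul_mem ht' hz'⟩, ?_⟩)
  change t * z * (d * a) = t * z * (b * c)
  simpa [mul_assoc] using ht

/-- A fraction of fractions `(a/s) / (b/t)` equals `(a t) / (b s)`. The new numerator and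
denominator do not depend on `q`, so local fractions correspond to local fractions. -/
theorem exists_localMap_toAway_eq (x y : Localization (Submonoid.powers f)) :
    ∃ a b : M, ∀ (q : top (Localization (Submonoid.powers f)))
      (hy : y ∈ MonoidPrime.compl (M := Localization (Submonoid.powers f)) q),
      ∃ hb : b ∈ MonoidPrime.compl (M := M) (MonoidPrime.comap (toAway f) q),
        localMap (toAway f) q (Localization.mk a ⟨b, hb⟩) = Localization.mk x ⟨y, hy⟩ := by
  induction x using Localization.induction_on with | H x =>
  induction y using Localization.induction_on with | H y =>
  obtain ⟨a, s⟩ := x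
  obtain ⟨b, t⟩ := y
  refine ⟨a * t, b * s, fun q hy => ⟨fun hb => hy ?_, ?_⟩⟩
  · refine (q.mk_mem_iff b t).2 ((q.mul_mem_iff_of_isUnit (isUnit_toAway f s) _).1 ?_)
    rw [← map_mul]
    exact hb
  · refine (localMap_mk (toAway f) q _ _ _).trans ?_
    refine Localization.mk_eq_mk_iff.2 (Localization.r_iff_exists.2 ⟨1, ?_⟩)
    change 1 * (Localization.mk b t * toAway f (a * t)) =
      1 * (toAway f (b * s) * Localization.mk a s)
    rw [one_mul, one_mul, map_mul, map_mul, ← mk_mul_toAway f a s, ← mk_mul_toAway f b t]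
    simp only [mul_left_comm, mul_comm]

theorem pullback_toAway_bijective (V : Opens (top M)) (hV : V ≤ basicOpens f) :
    Function.Bijective (pullback (toAway f) V) := by
  refine ⟨fun s t h => Subtype.ext (funext fun ⟨p, hp⟩ => ?_), fun t => ?_⟩
  · obtain ⟨q, rfl⟩ := exists_comap_toAway_eq (hV hp)
    exact localMap_toAway_injective q (congrFun (congrArg Subtype.val h) ⟨q, hp⟩)
  -- Quantifying over all `q` above `p` together with the equality lets the chosen values be used
  -- later with `rfl`, without transport.
  · have h₁ (p : V) : ∃ v : LocalizationAt M p.1, ∀ (q : top (Localization (Submonoid.powers f)))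
        (h : MonoidPrime.comap (toAway f) q = p.1),
        localMap (toAway f) q (h ▸ v) = t.1 ⟨q, by
          change MonoidPrime.comap (toAway f) q ∈ V
          exact h ▸ p.2⟩ := by
      obtain ⟨p, hp⟩ := p
      obtain ⟨q, rfl⟩ := exists_comap_toAway_eq (hV hp)
      obtain ⟨W, hW, i, x, y, k⟩ := t.2 ⟨q, hp⟩
      obtain ⟨hy, e⟩ := k ⟨q, hW⟩
      obtain ⟨a, b, hab⟩ := exists_localMap_toAway_eq x y
      obtain ⟨hb, e'⟩ := hab q hy
      refine ⟨Localization.mk a ⟨b, hb⟩, fun q' h => ?_⟩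
      obtain rfl := injective_comap_toAway h
      exact e'.trans e.symm
    choose s hs using h₁
    refine ⟨⟨s, fun ⟨p, hp⟩ => ?_⟩, Subtype.ext (funext fun q => hs ⟨_, q.2⟩ q.1 rfl)⟩
    obtain ⟨q, rfl⟩ := exists_comap_toAway_eq (hV hp)
    obtain ⟨W, hW, i, x, y, k⟩ := t.2 ⟨q, hp⟩
    obtain ⟨a, b, hab⟩ := exists_localMap_toAway_eq x y
    refine ⟨⟨MonoidPrime.comap (toAway f) '' W.1,
      isOpenEmbedding_comap_toAway.isOpenMap _ W.2⟩, ⟨q, hW, rfl⟩,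
      homOfLE (by rintro _ ⟨r, hr, rfl⟩; exact i.le hr), a, b, ?_⟩
    rintro ⟨_, r, hr, rfl⟩
    obtain ⟨hy, e⟩ := k ⟨r, hr⟩
    obtain ⟨hb, e'⟩ := hab r hy
    refine ⟨hb, localMap_toAway_injective r ?_⟩
    exact (hs ⟨_, i.le hr⟩ r rfl).trans (e.trans e'.symm)

instance isOpenImmersion_monoidSpecMap_toAway :
    AlgebraicGeometry.SheafedSpace.IsOpenImmersion (monoidSpecMap (toAway f)) where
  base_open := isOpenEmbedding_comap_toAway
  c_iso V := by
    refine (ConcreteCategory.isIso_iff_bijective _).2 (pullback_toAway_bijective _ ?_)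
    rintro _ ⟨q, -, rfl⟩
    exact (range_comap_toAway (f := f)).le ⟨q, rfl⟩

end Localization

open AlgebraicGeometry

/-! ### Open immersions and affine open subsets -/

section OpenImmersion

variable {X Y Z : SheafedSpace CommMonCat.{u}}

theorem CommMonCat.isUnit_of_isUnit_map {A B : CommMonCat.{u}} (φ : A ⟶ B) [IsIso φ] {a : A}
    (h : IsUnit (φ a)) : IsUnit a := by
  have h₁ := h.map (inv φ).hom
  have h₂ : (inv φ) (φ a) = a := by rw [← ConcreteCategory.comp_apply, IsIso.hom_inv_id]; rfl
  exact h₂ ▸ h₁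

theorem isUnit_map_of_le {U V W : Opens X} (i : V ⟶ U) (j : W ⟶ U) (k : W ⟶ V)
    {s : X.presheaf.obj (op U)} (h : IsUnit (X.presheaf.map i.op s)) :
    IsUnit (X.presheaf.map j.op s) := by
  have h₁ := h.map (X.presheaf.map k.op).hom
  have h₂ : X.presheaf.map k.op (X.presheaf.map i.op s) = X.presheaf.map j.op s := by
    rw [← ConcreteCategory.comp_apply, ← X.presheaf.map_comp]
    rfl
  exact h₂ ▸ h₁

theorem isUnit_map_map {U V W : Opens X} (i : V ⟶ U) (j : W ⟶ V) (k : W ⟶ U)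
    {s : X.presheaf.obj (op U)} (h : IsUnit (X.presheaf.map k.op s)) :
    IsUnit (X.presheaf.map j.op (X.presheaf.map i.op s)) := by
  rw [← ConcreteCategory.comp_apply, ← X.presheaf.map_comp]
  exact h

theorem IsLocalMonoidMorphism.of_isOpenImmersion (f : X ⟶ Y) [H : SheafedSpace.IsOpenImmersion f] :
    IsLocalMonoidMorphism f := by
  rintro x V hx s ⟨U, i, hU, h⟩
  have hi : H.base_open.functor.obj U ≤ V := by
    rintro _ ⟨y, hy, rfl⟩
    exact i.le hy
  refine ⟨H.base_open.functor.obj U, homOfLE hi, ⟨x, hU, rfl⟩, ?_⟩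
  apply CommMonCat.isUnit_of_isUnit_map (f.hom.c.app (op (H.base_open.functor.obj U)))
  have h₁ := ConcreteCategory.congr_hom (f.hom.c.naturality (homOfLE hi).op) s
  refine (congrArg IsUnit h₁).mpr ?_
  refine isUnit_map_of_le i ((Opens.map f.hom.base).map (homOfLE hi)) (homOfLE ?_) h
  rintro y ⟨z, hz, h⟩
  exact H.base_open.injective h ▸ hz

/-- A section `s` on `V` corresponds to a section `s'` on the open image of `V` in `Z`; locality of
the composite is applied to `s'`. -/
theorem IsLocalMonoidMorphism.of_comp (f : X ⟶ Y) (g : Y ⟶ Z) [H : SheafedSpace.IsOpenImmersion g]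
    (h : IsLocalMonoidMorphism (f ≫ g)) : IsLocalMonoidMorphism f := by
  rintro x V hx s ⟨U, i, hU, hs⟩
  let W := H.base_open.functor.obj V
  have hW : (Opens.map g.hom.base).obj W ≤ V := by
    rintro y ⟨z, hz, h⟩
    exact H.base_open.injective h ▸ hz
  have hW' : V ≤ (Opens.map g.hom.base).obj W := fun y hy => ⟨y, hy, rfl⟩
  obtain ⟨s', hs'⟩ := ((ConcreteCategory.isIso_iff_bijective (g.hom.c.app (op W))).1
    (H.c_iso V)).2 (Y.presheaf.map (homOfLE hW).op s)
  have h₁ := ConcreteCategory.congr_hom (f.hom.c.naturality (homOfLE hW).op) s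
  obtain ⟨W', j, hxW', hu⟩ := h x W ⟨_, hx, rfl⟩ s' ⟨U, homOfLE fun y hy => hW' (i.le hy), hU, by
    have h₂ : (f ≫ g).hom.c.app (op W) s' =
        X.presheaf.map ((Opens.map f.hom.base).map (homOfLE hW)).op (f.hom.c.app (op V) s) :=
      (congrArg (f.hom.c.app _) hs').trans h₁
    exact (congrArg (fun t => IsUnit (X.presheaf.map (homOfLE _).op t)) h₂).mpr
      (isUnit_map_map ((Opens.map f.hom.base).map (homOfLE hW)) (homOfLE _) i hs)⟩
  refine ⟨(Opens.map g.hom.base).obj W', (Opens.map g.hom.base).map j ≫ homOfLE hW, hxW', ?_⟩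
  have h₃ := ConcreteCategory.congr_hom (g.hom.c.naturality j.op) s'
  have h₄ := hu.map (g.hom.c.app (op W')).hom
  have h₅ : (g.hom.c.app (op W')).hom (Z.presheaf.map j.op s') =
      Y.presheaf.map ((Opens.map g.hom.base).map j).op (Y.presheaf.map (homOfLE hW).op s) :=
    h₃.trans (congrArg _ hs')
  rw [op_comp, Functor.map_comp, ConcreteCategory.comp_apply]
  exact h₅ ▸ h₄

/-- The factorisation of a morphism through an open immersion. -/
theorem exists_lift_of_range_subset (f : X ⟶ Z) (g : Y ⟶ Z) [SheafedSpace.IsOpenImmersion g]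
    (h : Set.range f.hom.base ⊆ Set.range g.hom.base) : ∃ l : X ⟶ Y, l ≫ g = f :=
  ⟨⟨PresheafedSpace.IsOpenImmersion.lift g.hom f.hom h⟩, by
    apply InducedCategory.hom_ext
    exact PresheafedSpace.IsOpenImmersion.lift_fac g.hom f.hom h⟩

/-- Two open immersions with the same image factor through each other, hence have isomorphic
sources. -/
theorem isAffineMonoidSpace_restrict_iff {U : Opens X} :
    IsAffineMonoidSpace (X.restrict U.isOpenEmbedding) ↔
      ∃ (M : Type u) (_ : CommMonoid M) (j : monoidSpec M ⟶ X),
        SheafedSpace.IsOpenImmersion j ∧ Set.range j.hom.base = U := by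
  have hr : Set.range (X.ofRestrict U.isOpenEmbedding).hom.base = U := Subtype.range_coe
  constructor
  · rintro ⟨M, _, ⟨e⟩⟩
    refine ⟨M, _, e.inv ≫ X.ofRestrict U.isOpenEmbedding, inferInstance, ?_⟩
    rw [← hr]
    refine Set.Subset.antisymm ?_ ?_
    · rintro _ ⟨p, rfl⟩
      exact ⟨e.inv.hom.base p, rfl⟩
    · rintro _ ⟨y, rfl⟩
      exact ⟨e.hom.hom.base y, congrArg (fun k : X.restrict U.isOpenEmbedding ⟶
        X.restrict U.isOpenEmbedding => (X.ofRestrict U.isOpenEmbedding).hom.base (k.hom.base y))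
        e.hom_inv_id⟩
  · rintro ⟨M, _, j, hj, h⟩
    obtain ⟨a, ha⟩ := exists_lift_of_range_subset j (X.ofRestrict U.isOpenEmbedding)
      (h.trans hr.symm).le
    obtain ⟨b, hb⟩ := exists_lift_of_range_subset (X.ofRestrict U.isOpenEmbedding) j
      (h.trans hr.symm).ge
    refine ⟨M, _, ⟨⟨b, a, ?_, ?_⟩⟩⟩
    · rw [← cancel_mono (X.ofRestrict U.isOpenEmbedding), Category.assoc, ha, hb, Category.id_comp]
    · rw [← cancel_mono j, Category.assoc, hb, ha, Category.id_comp]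

theorem exists_isAffineMonoidSpace_restrict {U V : Opens X}
    (hU : IsAffineMonoidSpace (X.restrict U.isOpenEmbedding)) {x : X} (hxU : x ∈ U) (hxV : x ∈ V) :
    ∃ A : Opens X, x ∈ A ∧ A ≤ V ∧ IsAffineMonoidSpace (X.restrict A.isOpenEmbedding) := by
  obtain ⟨M, _, j, hj, h⟩ := isAffineMonoidSpace_restrict_iff.1 hU
  obtain ⟨p, rfl⟩ := h.ge hxU
  obtain ⟨_, ⟨f, rfl⟩, hf, hfV⟩ :=
    MonoidPrime.isTopologicalBasis_basicOpen.exists_subset_of_mem_open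
    (show p ∈ (Opens.map j.hom.base).obj V from hxV) ((Opens.map j.hom.base).obj V).2
  refine ⟨⟨_, (hj.base_open.isOpenMap _ (MonoidPrime.isOpen_basicOpen f))⟩, ⟨p, hf, rfl⟩, ?_, ?_⟩
  · rintro _ ⟨q, hq, rfl⟩
    exact hfV hq
  · refine isAffineMonoidSpace_restrict_iff.2
      ⟨_, _, monoidSpecMap (toAway f) ≫ j, inferInstance, ?_⟩
    refine (Set.range_comp j.hom.base (MonoidPrime.comap (toAway f))).trans ?_
    exact congrArg (Set.image j.hom.base) range_comap_toAway

end OpenImmersion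

open AlgebraicGeometry

/-! ### Intersections of affine opens in a separated monoid scheme -/

/-- The canonical homomorphism to the localisation at a prime ideal. -/
def MonoidPrime.toLocalization {M : Type u} [CommMonoid M] (p : MonoidPrime M) :
    M →* Localization p.compl where
  toFun m := Localization.mk m 1
  map_one' := Localization.mk_one
  map_mul' := Localization.mk_mul_one

theorem MonoidPrime.comap_toLocalization_maximal {M : Type u} [CommMonoid M] (p : MonoidPrime M) :
    comap p.toLocalization (maximal _) = p :=
  MonoidPrime.ext (Set.ext fun m => (not_congr (p.isUnit_mk_iff m 1)).trans not_not)

theorem eq_top_of_maximal_mem {M : Type u} [CommMonoid M] {V : Opens (monoidSpec M)}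
    (h : MonoidPrime.maximal M ∈ V) : V = ⊤ :=
  Opens.ext (MonoidPrime.eq_univ_of_maximal_mem V.2 h)

namespace MonoidScheme

/-- The spectrum of a commutative monoid as a monoid scheme. -/
noncomputable def spec (M : Type u) [CommMonoid M] : MonoidScheme.{u} where
  toSheafedSpace := monoidSpec M
  local_affine _ := ⟨⊤, trivial, isAffineMonoidSpace_restrict_iff.2
    ⟨M, _, 𝟙 _, inferInstance, Set.range_id⟩⟩

/-- `M × N` is the coproduct of commutative monoids, so its spectrum behaves like `U × V`. It is
only mapped to `P.pt`; no identification with an open subset of the product is needed. -/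
theorem IsSeparated.inf_eq_bot_or_isAffineOpen {X : MonoidScheme.{u}} (hX : X.IsSeparated)
    {U V : Opens X.carrier} (hU : X.IsAffineOpen U) (hV : X.IsAffineOpen V) :
    U ⊓ V = ⊥ ∨ X.IsAffineOpen (U ⊓ V) := by
  obtain ⟨P, hP, hΔ⟩ := hX
  obtain ⟨M, _, j, _, hjU⟩ := isAffineMonoidSpace_restrict_iff.1 hU
  obtain ⟨N, _, k, _, hkV⟩ := isAffineMonoidSpace_restrict_iff.1 hV
  set Δ := hP.lift (BinaryFan.mk (𝟙 X) (𝟙 X))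
  have hj := IsLocalMonoidMorphism.of_isOpenImmersion j
  have hk := IsLocalMonoidMorphism.of_isOpenImmersion k
  have hΔ₁ : Δ ≫ P.fst = 𝟙 X := hP.fac _ ⟨WalkingPair.left⟩
  have hΔ₂ : Δ ≫ P.snd = 𝟙 X := hP.fac _ ⟨WalkingPair.right⟩
  let g₁ : spec (M × N) ⟶ X := ⟨monoidSpecMap (MonoidHom.inl M N) ≫ j,
    (isLocalMonoidMorphism_monoidSpecMap _).comp hj⟩
  let g₂ : spec (M × N) ⟶ X := ⟨monoidSpecMap (MonoidHom.inr M N) ≫ k,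
    (isLocalMonoidMorphism_monoidSpecMap _).comp hk⟩
  let g : spec (M × N) ⟶ P.pt := hP.lift (BinaryFan.mk g₁ g₂)
  have hg₁ : g ≫ P.fst = g₁ := hP.fac _ ⟨WalkingPair.left⟩
  have hg₂ : g ≫ P.snd = g₂ := hP.fac _ ⟨WalkingPair.right⟩
  have hbase {A B : MonoidScheme.{u}} {f f' : A ⟶ B} (h : f = f') (a : A.carrier) :
      f.hom.hom.base a = f'.hom.hom.base a := by rw [h]
  -- The image of the closed point of `Spec (M × N)`: any neighbourhood of `w` pulls back to all of
  -- `Spec (M × N)`.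
  let w : P.pt.carrier := g.hom.hom.base (MonoidPrime.maximal (M × N))
  have hw₁ : P.fst.hom.hom.base w ∈ U :=
    hjU.le ⟨_, (hbase hg₁ (MonoidPrime.maximal (M × N))).symm⟩
  have hw₂ : P.snd.hom.hom.base w ∈ V :=
    hkV.le ⟨_, (hbase hg₂ (MonoidPrime.maximal (M × N))).symm⟩
  obtain ⟨A₀, hwA₀, hA₀⟩ := P.pt.local_affine w
  obtain ⟨A, hwA, hAW, hA⟩ := exists_isAffineMonoidSpace_restrict
    (V := (Opens.map P.fst.hom.hom.base).obj U ⊓ (Opens.map P.snd.hom.hom.base).obj V)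
    hA₀ hwA₀ ⟨hw₁, hw₂⟩
  have key : (Opens.map Δ.hom.hom.base).obj A = U ⊓ V := by
    refine le_antisymm (fun x hx => ?_) fun x hx => ?_
    · have e₁ : P.fst.hom.hom.base (Δ.hom.hom.base x) = x := hbase hΔ₁ x
      have e₂ : P.snd.hom.hom.base (Δ.hom.hom.base x) = x := hbase hΔ₂ x
      exact ⟨(congrArg (· ∈ U) e₁).mp (hAW hx).1, (congrArg (· ∈ V) e₂).mp (hAW hx).2⟩
    · obtain ⟨(p : MonoidPrime M), hp⟩ := hjU.ge hx.1
      -- A local test object at `x`: the closed point of `Spec M_p` goes to `x`, so `f` lands in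
      -- every open set containing `x`, in particular in `V`.
      let f : spec (Localization p.compl) ⟶ X := ⟨monoidSpecMap p.toLocalization ≫ j,
        (isLocalMonoidMorphism_monoidSpecMap _).comp hj⟩
      have hf : f.hom.hom.base (MonoidPrime.maximal (Localization p.compl)) = x :=
        (congrArg j.hom.base p.comap_toLocalization_maximal).trans hp
      have hfV : (Opens.map f.hom.hom.base).obj V = ⊤ :=
        eq_top_of_maximal_mem ((congrArg (· ∈ V) hf).mpr hx.2)
      obtain ⟨l, hl⟩ := exists_lift_of_range_subset f.hom k (by
        rintro _ ⟨t, rfl⟩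
        exact hkV.ge (hfV.ge (Opens.mem_top t) :))
      obtain ⟨φ, rfl⟩ := exists_eq_monoidSpecMap l (.of_comp l k (hl ▸ f.isLocal))
      let h : spec (Localization p.compl) ⟶ spec (M × N) :=
        ⟨monoidSpecMap (p.toLocalization.coprod φ), isLocalMonoidMorphism_monoidSpecMap _⟩
      have hh₁ : h ≫ g₁ = f := Hom.ext (by
        refine (Category.assoc (monoidSpecMap (p.toLocalization.coprod φ)) _ j).symm.trans ?_
        rw [monoidSpecMap_comp, MonoidHom.coprod_comp_inl]
        rfl)
      have hh₂ : h ≫ g₂ = f := Hom.ext (by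
        refine (Category.assoc (monoidSpecMap (p.toLocalization.coprod φ)) _ k).symm.trans ?_
        rw [monoidSpecMap_comp, MonoidHom.coprod_comp_inr]
        exact hl)
      -- The diagonal of `f` factors through `Spec (M × N)`, all of which `g` sends into `A`; at the
      -- closed point this gives `Δ x ∈ A`.
      have hfg : f ≫ Δ = h ≫ g := BinaryFan.IsLimit.hom_ext hP
        ((Category.assoc f Δ P.fst).trans ((congrArg (f ≫ ·) hΔ₁).trans ((Category.comp_id f).trans
          (hh₁.symm.trans ((congrArg (h ≫ ·) hg₁).symm.trans (Category.assoc h g P.fst).symm)))))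
        ((Category.assoc f Δ P.snd).trans ((congrArg (f ≫ ·) hΔ₂).trans ((Category.comp_id f).trans
          (hh₂.symm.trans ((congrArg (h ≫ ·) hg₂).symm.trans (Category.assoc h g P.snd).symm)))))
      have e₁ : Δ.hom.hom.base x = g.hom.hom.base (h.hom.hom.base (MonoidPrime.maximal _)) :=
        (congrArg Δ.hom.hom.base hf).symm.trans (hbase hfg _)
      have hgA : (Opens.map g.hom.hom.base).obj A = ⊤ := eq_top_of_maximal_mem hwA
      exact (congrArg (· ∈ A) e₁).mpr (hgA.ge (Opens.mem_top _) :)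
  rw [← key]
  exact (hΔ A hA).1

theorem IsSeparated.iInf_eq_bot_or_isAffineOpen {X : MonoidScheme.{u}} (hX : X.IsSeparated)
    (n : ℕ) (U : Fin (n + 1) → Opens X.carrier) (hU : ∀ i, X.IsAffineOpen (U i)) :
    ⨅ i, U i = ⊥ ∨ X.IsAffineOpen (⨅ i, U i) := by
  induction n with
  | zero =>
    have h : ⨅ i, U i = U 0 := iInf_unique (ι := Fin 1) U
    rw [h]
    exact Or.inr (hU _)
  | succ n ih =>
    have h : ⨅ i, U i = U 0 ⊓ ⨅ i : Fin (n + 1), U i.succ :=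
      le_antisymm (le_inf (iInf_le _ _) (le_iInf fun i => iInf_le _ _))
        (le_iInf (Fin.cases inf_le_left fun i => inf_le_right.trans (iInf_le _ _)))
    rw [h]
    rcases ih (fun i => U i.succ) (fun i => hU _) with h | h
    · rw [h, inf_bot_eq]
      exact Or.inl rfl
    · exact hX.inf_eq_bot_or_isAffineOpen (hU 0) h

/-- Čech terms are indexed by categorical products of opens, which are finite intersections. -/
theorem IsSeparated.isSupercompactOrEmpty_pi {X : MonoidScheme.{u}} (hX : X.IsSeparated)
    (n : ℕ) (U : Fin (n + 1) → Opens X.carrier) (hU : ∀ i, X.IsAffineOpen (U i)) :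
    IsSupercompactOrEmpty (X := X.carrier) (∏ᶜ U) := by
  have h : ∏ᶜ U = ⨅ i, U i := le_antisymm (le_iInf fun i => (Pi.π U i).le)
    (Pi.lift fun i => homOfLE (iInf_le U i)).le
  rw [h]
  exact (hX.iInf_eq_bot_or_isAffineOpen n U hU).elim Or.inl fun h => h.isSupercompactOrEmpty

end MonoidScheme

end

theorem mainTheorem10 (X : MonoidScheme.{u}) :
    (X.IsAffine →
      (∀ (F : TopCat.Sheaf GrpCat.{u} X.carrier) (c : NonabelianH1 F), c = 1) ∧
      (∀ (F : TopCat.Sheaf AddCommGrpCat.{u} X.carrier) (i : ℕ), 1 ≤ i →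
        Subsingleton ((sheafCohomology X.carrier i).obj F))) ∧
    (X.IsSeparated →
      ∀ (ι : Type u) (U : ι → Opens X.carrier), (∀ i, X.IsAffineOpen (U i)) →
        (∀ x : X.carrier, ∃ i, x ∈ U i) →
        ∀ n : ℕ, Nonempty (coverCohomology U n ≅ sheafCohomology X.carrier n)) := by
  refine ⟨fun hX => ?_, fun hX ι U hU hcov n => ?_⟩
  · obtain ⟨x, hx⟩ := hX.exists_forall_mem_imp_eq_top
    refine ⟨fun F c => NonabelianH1.eq_one F x hx c, fun F i hi => ?_⟩
    exact subsingleton_sheafCohomology (Or.inr ⟨x, trivial, fun V hV => (hx V hV).ge⟩) F i hi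
  · exact Limits.FormalCoproduct.nonempty_cech_iso_sheafCohomology U hcov
      (fun m i => hX.isSupercompactOrEmpty_pi m (fun k => U (i k)) fun k => hU (i k)) n
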